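/- Let $m\ge 5$ be odd, let $n=\frac{3^m-1}{2}$, let $\alpha$ be a generator of $\mathrm{GF}(3^m)^*$, and let $\mathrm{Tr}$ be the trace from $\mathrm{GF}(3^m)$ to $\mathrm{GF}(3)$. Let $$\mathcal C\left(0,1,\dots,\lfloor \tfrac m2\rfloor\right)=\left\{\left(\mathrm{Tr}\Big(\sum_{j=0}^{\lfloor m/2\rfloor} a_j\,\alpha^{(3^{j}+1)i}\Big)\right)_{i=0}^{n-1} : a_0,\dots,a_{\lfloor m/2\rfloor}\in \mathrm{GF}(3^m)\right\}\subseteq \mathrm{GF}(3)^n .$$ For a linear code $C\subseteq \mathrm{GF}(3)^n$ let $A_w(C)$ be the number of codewords of Hamming weight $w$, let $C^\perp$ be the dual code for the standard inner product, and let $\mathcal B_w(C)$ be the set of supports of the codewords of $C$ of Hamming weight $w$. A set $\mathcal B$ of subsets of a $\nu$-element set $\mathcal P$ is a $t$-$(\nu,k,\lambda)$ design (where $0<t<k<\nu$) if $\mathcal B\neq\emptyset$, every member of $\mathcal B$ has $k$ elements, and every $t$-subset of $\mathcal P$ is contained in exactly $\lambda$ members of $\mathcal B$. Put $$\lambda_4^\perp=1,\qquad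 \lambda_5^\perp=3^{m-1}-9,\qquad \lambda_6^\perp=\tfrac34\left(3^{2m-2}-38\cdot 3^{m-2}+53\right),$$ $$\lambda_7^\perp=\tfrac{3}{20}\left(3^{3m-2}-5\cdot 3^{2m}+1006\cdot 3^{m-2}-1000\right).$$ **Theorem.** Let $C$ be a linear subcode of $\mathcal C(0,1,\dots,\lfloor m/2\rfloor)$ with weight distribution $A_0=1$, $$A_{3^{m-1}-3^{(m-1)/2}}=\tfrac12\left(3^{m-1}+3^{\frac{m-1}2}\right)(3^m-1),\quad A_{3^{m-1}}=(2\cdot 3^{m-1}+1)(3^m-1),\quad A_{3^{m-1}+3^{(m-1)/2}}=\tfrac12\left(3^{m-1}-3^{\frac{m-1}2}\right)(3^m-1),$$ and $A_w=0$ for all other $w$. Then for every $k\in\{4,5,6,7\}$ the set $\mathcal B_k(C^\perp)$ is a $2$-$\left(\frac{3^m-1}2,k,\lambda_k^\perp\right)$ design on the set of coordinate positions. In particular (confirming a conjecture of Ding and Li for these $k$), the same conclusion holds when $C$ is either of the codes $$\mathcal C_1=\left\{\left(\mathrm{Tr}\left(a\alpha^{4i}+b\alpha^{2i}\right)\right)_{i=0}^{n-1}: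 a,b\in\mathrm{GF}(3^m)\right\},$$ $$\mathcal C_2=\left\{\left(\mathrm{Tr}\left(a\alpha^{(3^{(m-3)/2}+1)i}+b\alpha^{(3^{(m-1)/2}+1)i}\right)\right)_{i=0}^{n-1}: a,b\in\mathrm{GF}(3^m)\right\}.$$ -/

import Mathlib

namespace TernaryDesigns

/-- A collection `B` of subsets of the finite point set `P` is a simple `t`-`(ν, k, lam)` design:
`P` has `ν` points, `B` is a nonempty set of `k`-subsets of `P`, and every `t`-subset of `P` is
contained in exactly `lam` members of `B`, where `0 < t < k < ν`. -/
structure IsTDesign {P : Type*} [Fintype P] (t ν k lam : ℕ) (B : Set (Finset P)) : Prop where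
  card_points : Fintype.card P = ν
  t_pos : 0 < t
  t_lt : t < k
  k_lt : k < ν
  nonempty : B.Nonempty
  block_card : ∀ b ∈ B, b.card = k
  balanced : ∀ T : Finset P, T.card = t → {b ∈ B | T ⊆ b}.ncard = lam

/-- The support of a vector. -/
def supp {n : ℕ} (c : Fin n → ZMod 3) : Finset (Fin n) :=
  Finset.univ.filter fun i => c i ≠ 0

/-- The set of codewords of Hamming weight `w`. -/
def weightSet {n : ℕ} (C : Submodule (ZMod 3) (Fin n → ZMod 3)) (w : ℕ) :
    Set (Fin n → ZMod 3) :=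
  {c | c ∈ C ∧ hammingNorm c = w}

/-- `A_w(C)`, the number of codewords of Hamming weight `w`. -/
noncomputable def weightCount {n : ℕ} (C : Submodule (ZMod 3) (Fin n → ZMod 3)) (w : ℕ) : ℕ :=
  (weightSet C w).ncard

/-- `B_w(C)`, the set of supports of the codewords of Hamming weight `w`. -/
def blocks {n : ℕ} (C : Submodule (ZMod 3) (Fin n → ZMod 3)) (w : ℕ) : Set (Finset (Fin n)) :=
  supp '' weightSet C w

/-- The dual code for the standard inner product. -/
def dualCode {n : ℕ} (C : Submodule (ZMod 3) (Fin n → ZMod 3)) :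
    Submodule (ZMod 3) (Fin n → ZMod 3) where
  carrier := {w | ∀ c ∈ C, ∑ i, w i * c i = 0}
  zero_mem' := by
    intro c _
    simp
  add_mem' := by
    intro u v hu hv c hc
    simp only [Pi.add_apply, add_mul, Finset.sum_add_distrib]
    rw [hu c hc, hv c hc, add_zero]
  smul_mem' := by
    intro r u hu c hc
    simp only [Pi.smul_apply, smul_eq_mul, mul_assoc, ← Finset.mul_sum]
    rw [hu c hc, mul_zero]

/-- The ternary code of length `n` consisting of the vectors
`(Tr (∑ j, a j * α ^ (e j * i)))_{0 ≤ i < n}` with all `a j` in the field `F`. -/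
def traceCode {F : Type*} [Field F] [Algebra (ZMod 3) F] (α : F) (n : ℕ)
    {ι : Type*} [Fintype ι] (e : ι → ℕ) : Submodule (ZMod 3) (Fin n → ZMod 3) where
  carrier := {c | ∃ a : ι → F, ∀ i : Fin n,
    c i = Algebra.trace (ZMod 3) F (∑ j, a j * α ^ (e j * (i : ℕ)))}
  zero_mem' := ⟨0, by simp⟩
  add_mem' := by
    rintro u v ⟨a, ha⟩ ⟨b, hb⟩
    refine ⟨a + b, fun i => ?_⟩
    simp only [Pi.add_apply, add_mul, Finset.sum_add_distrib, map_add]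
    rw [ha i, hb i]
  smul_mem' := by
    rintro r u ⟨a, ha⟩
    refine ⟨r • a, fun i => ?_⟩
    simp only [Pi.smul_apply, smul_mul_assoc, ← Finset.smul_sum, map_smul]
    rw [ha i]

/-- The code `C(E)` of length `(3 ^ m - 1) / 2`, with exponents `3 ^ k + 1` for `k ∈ E`. -/
def codeE {F : Type*} [Field F] [Algebra (ZMod 3) F] (α : F) (m : ℕ) (E : Finset ℕ) :
    Submodule (ZMod 3) (Fin ((3 ^ m - 1) / 2) → ZMod 3) :=
  traceCode α ((3 ^ m - 1) / 2) fun k : E => 3 ^ (k : ℕ) + 1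

/-- The code `C(0, 1, …, ⌊m / 2⌋)`. -/
def fullCode {F : Type*} [Field F] [Algebra (ZMod 3) F] (α : F) (m : ℕ) :
    Submodule (ZMod 3) (Fin ((3 ^ m - 1) / 2) → ZMod 3) :=
  codeE α m (Finset.range (m / 2 + 1))

/-- The code of the vectors `(Tr (a α ^ (4 i) + b α ^ (2 i)))_i`. -/
def codeOne {F : Type*} [Field F] [Algebra (ZMod 3) F] (α : F) (m : ℕ) :
    Submodule (ZMod 3) (Fin ((3 ^ m - 1) / 2) → ZMod 3) :=
  traceCode α ((3 ^ m - 1) / 2) ![4, 2]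

/-- The code of the vectors
`(Tr (a α ^ ((3 ^ ((m - 3) / 2) + 1) i) + b α ^ ((3 ^ ((m - 1) / 2) + 1) i)))_i`. -/
def codeTwo {F : Type*} [Field F] [Algebra (ZMod 3) F] (α : F) (m : ℕ) :
    Submodule (ZMod 3) (Fin ((3 ^ m - 1) / 2) → ZMod 3) :=
  traceCode α ((3 ^ m - 1) / 2) ![3 ^ ((m - 3) / 2) + 1, 3 ^ ((m - 1) / 2) + 1]

/-- The three-weight distribution: `A_w` as a rational number. -/
def threeWeightFreq (m w : ℕ) : ℚ :=
  if w = 0 then 1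
  else if w = 3 ^ (m - 1) - 3 ^ ((m - 1) / 2) then
    1 / 2 * (3 ^ (m - 1) + 3 ^ ((m - 1) / 2)) * (3 ^ m - 1)
  else if w = 3 ^ (m - 1) then (2 * 3 ^ (m - 1) + 1) * (3 ^ m - 1)
  else if w = 3 ^ (m - 1) + 3 ^ ((m - 1) / 2) then
    1 / 2 * (3 ^ (m - 1) - 3 ^ ((m - 1) / 2)) * (3 ^ m - 1)
  else 0

/-- `C` has the three-weight distribution `threeWeightFreq m`. -/
def HasThreeWeightDistribution {n : ℕ} (m : ℕ) (C : Submodule (ZMod 3) (Fin n → ZMod 3)) : Prop :=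
  ∀ w : ℕ, (weightCount C w : ℚ) = threeWeightFreq m w

/-- The values `λ_k^⊥` for `k = 4, 5, 6, 7` (and the unused value `0` for all other `k`). -/
def lambdaDual (m : ℕ) : ℕ → ℚ
  | 4 => 1
  | 5 => 3 ^ (m - 1) - 9
  | 6 => 3 / 4 * (3 ^ (2 * m - 2) - 38 * 3 ^ (m - 2) + 53)
  | 7 => 3 / 20 * (3 ^ (3 * m - 2) - 5 * 3 ^ (2 * m) + 1006 * 3 ^ (m - 2) - 1000)
  | _ => 0

/-- For each `k ∈ {4, 5, 6, 7}`, the supports of the weight-`k` codewords of the dual of `C` form a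
`2`-`((3 ^ m - 1) / 2, k, λ_k^⊥)` design. -/
def DualHoldsDesigns (m : ℕ) (C : Submodule (ZMod 3) (Fin ((3 ^ m - 1) / 2) → ZMod 3)) : Prop :=
  ∀ k ∈ ({4, 5, 6, 7} : Finset ℕ), ∃ lam : ℕ, (lam : ℚ) = lambdaDual m k ∧
    IsTDesign 2 ((3 ^ m - 1) / 2) k lam (blocks (dualCode C) k)

end TernaryDesigns

/-! ### Characters and the MacWilliams identity -/

namespace TernaryDesigns
open Polynomial

/-! The coordinates are the points of PG(m-1, 3): since `α ^ n = -1`, the powers `α ^ i`, `i < n`,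
represent the nonzero field elements up to sign. A codeword is the value table of a ternary
quadratic form `q`, and `q x + q y + q (x + y) + q (x - y) = 0`, so the indicator of every
projective line is a dual word of weight 4. Hence each pair of points lies in the support of at
least two dual words of weight 4, one line and two signs (`two_le_card_wordsOn_four`).

Put `s = 3 ^ ((m - 1) / 2)`. By MacWilliams, the weight distribution leaves no dual words of weight
1, 2, 3 and exactly `n (n - 1) / 6` of weight 4, an average of two through each pair. The lower
bound is therefore attained at every pair (`HasDistribution.card_wordsOn_four`). This number fixes
the first three moments of the words of `C` vanishing at two given points, and three moments
determine three frequencies (`shortened_two`). A MacWilliams identity for dual words nonzero at both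
points then gives a count of dual words of weight `k` that does not depend on the pair
(`card_wordsOn_eq`, `HasDistribution.card_wordsOn`).

To pass from words to supports: if two dual words `c`, `d` share a support, the weights of `c - d`
and `c + d` add up to at most 7, so one of these words has weight below 4 and is zero. Each block
thus carries exactly two words.

For the two explicit codes the distribution has to be proved. The exponential sum of `q` has squared
modulus `3 ^ m * |rad|`; arithmetic of `u ^ 2 + 3 v ^ 2` turns a radical of order at most 9 into the
three weights (`weight_of_ker`), and dual distance at least 3 fixes the frequencies by moments.
Radicals are bounded by roots of linearized polynomials. For the second code the degree is 27, and
order 27 is excluded because `-1` is not a square (`card_ne_of_linearized`). -/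

/-- The codewords of `C` as a finite set. -/
noncomputable def words {n : ℕ} (C : Submodule (ZMod 3) (Fin n → ZMod 3)) :
    Finset (Fin n → ZMod 3) :=
  open Classical in Finset.univ.filter fun c => c ∈ C

@[simp]
theorem mem_words {n : ℕ} {C : Submodule (ZMod 3) (Fin n → ZMod 3)} {c : Fin n → ZMod 3} :
    c ∈ words C ↔ c ∈ C := by
  simp [words]

theorem card_words {n : ℕ} (C : Submodule (ZMod 3) (Fin n → ZMod 3)) :
    (words C).card = Nat.card C := by
  classical
  rw [words, ← Fintype.card_subtype, Nat.card_eq_fintype_card]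

/-- Orthogonality of characters on `C`. Testing on all multiples `t • c` and using that `ψ` is
primitive turns triviality of the character into orthogonality of `v` and `c`. -/
theorem sum_words_addChar {R : Type*} [CommRing R] [IsDomain R] {ψ : AddChar (ZMod 3) R}
    (hψ : ψ.IsPrimitive) {n : ℕ} (C : Submodule (ZMod 3) (Fin n → ZMod 3))
    (v : Fin n → ZMod 3) [Decidable (v ∈ dualCode C)] :
    ∑ u ∈ words C, ψ (∑ l, v l * u l) = if v ∈ dualCode C then (Nat.card C : R) else 0 := by
  classical
  let f : C →+ ZMod 3 :=
    { toFun := fun u => ∑ l, v l * (u : Fin n → ZMod 3) l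
      map_zero' := by simp
      map_add' := by intro x y; simp [mul_add, Finset.sum_add_distrib] }
  have h1 : ∑ u ∈ words C, ψ (∑ l, v l * u l) = ∑ u : C, (ψ.compAddMonoidHom f) u := by
    rw [words, Finset.sum_filter, ← Finset.sum_filter,
      Finset.sum_subtype (p := fun c => c ∈ C) _ (by simp)]
    rfl
  rw [h1, AddChar.sum_eq_ite, Nat.card_eq_fintype_card]
  refine if_congr ?_ rfl rfl
  constructor
  · intro h c hc
    by_contra hne
    refine hψ hne ?_
    ext t
    have h2 := DFunLike.congr_fun h (t • (⟨c, hc⟩ : C))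
    simp only [AddChar.compAddMonoidHom_apply, AddChar.zero_apply] at h2
    have h3 : f (t • (⟨c, hc⟩ : C)) = (∑ l, v l * c l) * t := by
      simp only [f, AddMonoidHom.coe_mk, ZeroHom.coe_mk, Submodule.coe_smul, Pi.smul_apply,
        smul_eq_mul, Finset.sum_mul]
      exact Finset.sum_congr rfl fun l _ => by ring
    rw [h3] at h2
    simpa [AddChar.mulShift_apply] using h2
  · intro h
    ext u
    simp only [AddChar.compAddMonoidHom_apply, AddChar.zero_apply]
    have : f u = 0 := h u u.2
    rw [this, AddChar.map_zero_eq_one]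

theorem map_sum_eq_prod {A M ι : Type*} [AddCommMonoid A] [CommMonoid M] (ψ : AddChar A M)
    (s : Finset ι) (f : ι → A) : ψ (∑ i ∈ s, f i) = ∏ i ∈ s, ψ (f i) := by
  classical
  induction s using Finset.induction_on with
  | empty => simp
  | insert a s ha ih => rw [Finset.sum_insert ha, Finset.prod_insert ha, AddChar.map_add_eq_mul, ih]

/-- Poisson summation: the Fourier transform of a product of local functions is the product of the
local transforms, and exchanging sums leaves orthogonality. -/
theorem macWilliams_addChar {R : Type*} [CommRing R] [IsDomain R] {ψ : AddChar (ZMod 3) R}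
    (hψ : ψ.IsPrimitive) {n : ℕ} (C : Submodule (ZMod 3) (Fin n → ZMod 3))
    (g : Fin n → ZMod 3 → R) :
    (Nat.card C : R) * ∑ c ∈ words (dualCode C), ∏ l, g l (c l) =
      ∑ u ∈ words C, ∏ l, ∑ v, ψ (v * u l) * g l v := by
  classical
  have h1 : ∀ u : Fin n → ZMod 3, ∏ l, ∑ v, ψ (v * u l) * g l v =
      ∑ v : Fin n → ZMod 3, ψ (∑ l, v l * u l) * ∏ l, g l (v l) := by
    intro u
    rw [Finset.prod_univ_sum, Fintype.piFinset_univ]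
    refine Finset.sum_congr rfl fun v _ => ?_
    rw [Finset.prod_mul_distrib, map_sum_eq_prod]
  simp_rw [h1]
  rw [Finset.sum_comm]
  simp_rw [← Finset.sum_mul, sum_words_addChar hψ C, ite_mul, zero_mul]
  rw [← Finset.sum_filter, Finset.mul_sum, words]

/-- MacWilliams identity for products of functions that only depend on whether a coordinate
vanishes. -/
theorem macWilliams {n : ℕ} (C : Submodule (ZMod 3) (Fin n → ZMod 3)) (p r : Fin n → ℚ[X]) :
    (Nat.card C : ℚ[X]) * ∑ c ∈ words (dualCode C), ∏ l, (if c l = 0 then p l else r l) =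
      ∑ u ∈ words C, ∏ l, (if u l = 0 then p l + 2 * r l else p l - r l) := by
  -- Cube roots of unity are needed, so the identity is proved over `ℂ[X]` and pulled back along an
  -- injective map. There `1 + ω + ω² = 0` reduces the local transform to `p + 2 r` or `p - r`.
  let ι : ℚ[X] →+* ℂ[X] := mapRingHom (algebraMap ℚ ℂ)
  have hι : Function.Injective ι := map_injective _ (algebraMap ℚ ℂ).injective
  let ψ : AddChar (ZMod 3) ℂ[X] :=
    (Polynomial.C : ℂ →+* ℂ[X]).toMonoidHom.compAddChar (ZMod.stdAddChar (N := 3))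
  have hψ : ψ.IsPrimitive := by
    refine AddChar.IsPrimitive.of_ne_one ?_
    intro h
    have h1 := DFunLike.congr_fun h 1
    have h2 : (ZMod.stdAddChar (N := 3)) 1 = 1 := by
      apply C_injective
      simpa [ψ] using h1
    have h3 := ZMod.injective_stdAddChar (N := 3) (h2.trans (AddChar.map_zero_eq_one _).symm)
    exact absurd h3 (by decide)
  have hs : ∀ f : ZMod 3 → ℂ[X], ∑ v, f v = f 0 + f 1 + f 2 := fun f => Fin.sum_univ_three f
  have hsum : 1 + ψ 1 + ψ 2 = 0 := by
    have := AddChar.sum_eq_zero_of_ne_one (ψ := ψ) (fun h => hψ one_ne_zero (by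
      rw [AddChar.mulShift_one, h]))
    rw [hs, AddChar.map_zero_eq_one] at this
    exact this
  apply hι
  have := macWilliams_addChar hψ C fun l v => ι (if v = 0 then p l else r l)
  simp only [map_mul, map_natCast, map_sum, map_prod]
  rw [this]
  refine Finset.sum_congr rfl fun u _ => Finset.prod_congr rfl fun l _ => ?_
  rw [hs]
  have h10 : (1 : ZMod 3) ≠ 0 := by decide
  have h20 : (2 : ZMod 3) ≠ 0 := by decide
  have hcase : u l = 0 ∨ u l = 1 ∨ u l = 2 := by
    generalize u l = t
    revert t
    decide
  rcases hcase with h | h | h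
  · simp [h, h20, two_mul, add_assoc]
  · simp [h, h20]
    linear_combination ι (r l) * hsum
  · have h4 : (2 * 2 : ZMod 3) = 1 := by decide
    simp [h, h20, h4]
    linear_combination ι (r l) * hsum

end TernaryDesigns

/-! ### Krawtchouk coefficients and localized MacWilliams identities -/

namespace TernaryDesigns
open Polynomial

/-- The coefficient of `X ^ k` in `(1 + 2 X) ^ N (1 - X) ^ M`. -/
noncomputable def kraw (N M k : ℕ) : ℚ :=
  (((1 + 2 * X) ^ N * (1 - X) ^ M : ℚ[X])).coeff k

theorem kraw_zero (N M : ℕ) : kraw N M 0 = 1 := by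
  simp [kraw, coeff_zero_eq_eval_zero]

/-- The logarithmic derivative gives `(1 + 2X)(1 - X) f' = (2N(1 - X) - M(1 + 2X)) f`. Its
coefficients form a three-term recurrence that makes `kraw` explicit for small `k`. -/
theorem derivative_kraw_aux (N M : ℕ) :
    derivative ((1 + 2 * X) ^ N * (1 - X) ^ M : ℚ[X]) +
        X * derivative ((1 + 2 * X) ^ N * (1 - X) ^ M : ℚ[X]) -
        Polynomial.C 2 * (X * (X * derivative ((1 + 2 * X) ^ N * (1 - X) ^ M : ℚ[X]))) =
      Polynomial.C (2 * N - M : ℚ) * ((1 + 2 * X) ^ N * (1 - X) ^ M : ℚ[X]) -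
        Polynomial.C (2 * N + 2 * M : ℚ) * (X * ((1 + 2 * X) ^ N * (1 - X) ^ M : ℚ[X])) := by
  have h1 : (1 + 2 * X) * derivative ((1 + 2 * X : ℚ[X]) ^ N) =
      2 * (N : ℚ[X]) * (1 + 2 * X) ^ N := by
    rcases N with _ | N
    · simp
    · rw [derivative_pow_succ]
      simp
      ring
  have h2 : (1 - X) * derivative ((1 - X : ℚ[X]) ^ M) = - (M : ℚ[X]) * (1 - X) ^ M := by
    rcases M with _ | M
    · simp
    · rw [derivative_pow_succ]
      simp
      ring
  have hC : Polynomial.C (2 : ℚ) = 2 := rfl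
  rw [derivative_mul]
  simp only [map_sub, map_add, map_mul, map_natCast, map_ofNat]
  linear_combination (1 - X) * (1 - X) ^ M * h1 + (1 + 2 * X) * (1 + 2 * X) ^ N * h2

theorem kraw_one (N M : ℕ) : kraw N M 1 = 2 * N - M := by
  have h := congrArg (fun f => coeff f 0) (derivative_kraw_aux N M)
  simp only [coeff_sub, coeff_add, coeff_C_mul, coeff_X_mul_zero, coeff_derivative] at h
  have h0 := kraw_zero N M
  simp only [kraw] at h0 ⊢
  rw [h0] at h
  simpa using h

theorem kraw_add_two (N M k : ℕ) : kraw N M (k + 2) =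
    ((2 * N - M - (k + 1)) * kraw N M (k + 1) + (2 * k - 2 * N - 2 * M) * kraw N M k) / (k + 2) := by
  have h := congrArg (fun f => coeff f (k + 1)) (derivative_kraw_aux N M)
  have hX : ∀ f : ℚ[X], (X * derivative f).coeff k = k * f.coeff k := by
    intro f
    rcases k with _ | k
    · simp
    · rw [coeff_X_mul, coeff_derivative]
      push_cast
      ring
  simp only [coeff_sub, coeff_add, coeff_C_mul, coeff_X_mul, hX, coeff_derivative] at h
  rw [eq_div_iff (by positivity)]
  simp only [kraw]
  push_cast at h
  linear_combination h

theorem kraw_two (N M : ℕ) : kraw N M 2 = ((2 * N - M - 1) * (2 * N - M) - 2 * N - 2 * M) / 2 := by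
  rw [kraw_add_two, kraw_one, kraw_zero]
  push_cast
  ring

theorem kraw_three (N M : ℕ) : kraw N M 3 =
    ((2 * N - M - 2) * kraw N M 2 + (2 - 2 * N - 2 * M) * (2 * N - M)) / 3 := by
  have := kraw_add_two N M 1
  norm_num at this
  rw [this, kraw_one]

theorem kraw_four (N M : ℕ) : kraw N M 4 =
    ((2 * N - M - 3) * kraw N M 3 + (4 - 2 * N - 2 * M) * kraw N M 2) / 4 := by
  have := kraw_add_two N M 2
  norm_num at this
  rw [this]

theorem kraw_five (N M : ℕ) : kraw N M 5 =
    ((2 * N - M - 4) * kraw N M 4 + (6 - 2 * N - 2 * M) * kraw N M 3) / 5 := by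
  have := kraw_add_two N M 3
  norm_num at this
  rw [this]

theorem prod_ite_eq_pow_mul_pow {n : ℕ} {R : Type*} [CommMonoid R] (S : Finset (Fin n))
    (u : Fin n → ZMod 3) (a b : R) :
    ∏ l ∈ S, (if u l = 0 then a else b) =
      a ^ (S.filter fun l => u l = 0).card * b ^ (S.filter fun l => u l ≠ 0).card := by
  rw [Finset.prod_ite, Finset.prod_const, Finset.prod_const]

/-- MacWilliams identity for the dual code punctured on `T`. -/
theorem macWilliams_puncture {n : ℕ} (C : Submodule (ZMod 3) (Fin n → ZMod 3))
    (T : Finset (Fin n)) (k : ℕ) :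
    (Nat.card C : ℚ) * ((words (dualCode C)).filter
        fun c => (Tᶜ.filter fun l => c l ≠ 0).card = k).card =
      3 ^ T.card * ∑ u ∈ (words C).filter (fun u => ∀ l ∈ T, u l = 0),
        kraw (n - T.card - hammingNorm u) (hammingNorm u) k := by
  -- The constant 1 on `T` ignores those coordinates; its transform is 3 at zero and 0 elsewhere, so
  -- only words vanishing on `T` survive on the other side.
  have h := congrArg (fun f => coeff f k) (macWilliams C (fun _ => 1)
    fun l => if l ∈ T then 1 else X)
  have h1 : ∀ c : Fin n → ZMod 3,
      ∏ l, (if c l = 0 then (1 : ℚ[X]) else if l ∈ T then 1 else X) =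
        X ^ (Tᶜ.filter fun l => c l ≠ 0).card := by
    intro c
    rw [← Finset.prod_mul_prod_compl T, Finset.prod_eq_one, one_mul]
    · rw [← one_mul (X ^ _), ← one_pow (Tᶜ.filter fun l => c l = 0).card,
        ← prod_ite_eq_pow_mul_pow]
      refine Finset.prod_congr rfl fun l hl => ?_
      rw [if_neg (Finset.mem_compl.1 hl), one_pow]
    · intro l hl
      simp [hl]
  have h2 : ∀ u : Fin n → ZMod 3,
      ∏ l, (if u l = 0 then (1 : ℚ[X]) + 2 * (if l ∈ T then 1 else X)
        else 1 - if l ∈ T then 1 else X) =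
      if ∀ l ∈ T, u l = 0 then 3 ^ T.card * ((1 + 2 * X) ^ (n - T.card - hammingNorm u) *
        (1 - X) ^ hammingNorm u) else 0 := by
    intro u
    rw [← Finset.prod_mul_prod_compl T]
    split_ifs with hu
    · congr 1
      · rw [Finset.prod_congr rfl (g := fun _ => 3), Finset.prod_const]
        intro l hl
        simp only [hu l hl, if_true]
        norm_num
      · have hn : (Tᶜ.filter fun l => u l ≠ 0).card = hammingNorm u := by
          rw [hammingNorm]
          congr 1
          ext l
          simp only [Finset.mem_filter, Finset.mem_compl, Finset.mem_univ, true_and,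
            and_iff_right_iff_imp]
          exact fun h hl => h (hu l hl)
        have hz : (Tᶜ.filter fun l => u l = 0).card = n - T.card - hammingNorm u := by
          have := Finset.card_filter_add_card_filter_not (s := Tᶜ) fun l => u l = 0
          rw [Finset.card_compl, Fintype.card_fin] at this
          have h3 : (Tᶜ.filter fun l => ¬ u l = 0).card = hammingNorm u := hn
          omega
        rw [← hz, ← hn, ← prod_ite_eq_pow_mul_pow]
        refine Finset.prod_congr rfl fun l hl => ?_
        rw [if_neg (Finset.mem_compl.1 hl)]
    · push Not at hu
      obtain ⟨l, hl, hul⟩ := hu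
      rw [Finset.prod_eq_zero hl, zero_mul]
      simp [hul]
  simp only [h1, h2] at h
  rw [← Finset.sum_filter, ← Finset.mul_sum] at h
  have e1 : ((3 : ℚ[X]) ^ T.card) = Polynomial.C ((3 : ℚ) ^ T.card) := by
    rw [C_pow]; rfl
  have e2 : ((Nat.card C : ℕ) : ℚ[X]) = Polynomial.C ((Nat.card C : ℕ) : ℚ) := by simp
  rw [e1, e2, coeff_C_mul, coeff_C_mul, finsetSum_coeff, finsetSum_coeff] at h
  simp only [coeff_X_pow] at h
  rw [Finset.sum_boole] at h
  simpa only [kraw, eq_comm (a := k)] using h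

/-- MacWilliams identity for the dual codewords without zeros on `T`. -/
theorem macWilliams_support {n : ℕ} (C : Submodule (ZMod 3) (Fin n → ZMod 3))
    (T : Finset (Fin n)) (k : ℕ) :
    (Nat.card C : ℚ) * ((words (dualCode C)).filter
        fun c => (∀ l ∈ T, c l ≠ 0) ∧ hammingNorm c = k + T.card).card =
      ∑ u ∈ words C, (∏ l ∈ T, if u l = 0 then (2 : ℚ) else -1) *
        kraw (Tᶜ.filter fun l => u l = 0).card (Tᶜ.filter fun l => u l ≠ 0).card k := by
  -- On `T` the local function kills zeros, and its transform is `2X` or `-X`. The resulting factor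
  -- `X ^ T.card` explains the shift of the coefficient.
  have h := congrArg (fun f => coeff f (k + T.card))
    (macWilliams C (fun l => if l ∈ T then 0 else 1) fun _ => X)
  have h1 : ∀ c : Fin n → ZMod 3,
      ∏ l, (if c l = 0 then (if l ∈ T then 0 else 1) else (X : ℚ[X])) =
        if ∀ l ∈ T, c l ≠ 0 then X ^ hammingNorm c else 0 := by
    intro c
    split_ifs with hc
    · rw [hammingNorm, ← one_mul (X ^ _),
        ← one_pow (Finset.univ.filter fun l => c l = 0).card, ← prod_ite_eq_pow_mul_pow]
      refine Finset.prod_congr rfl fun l _ => ?_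
      by_cases hl : l ∈ T
      · simp [hc l hl]
      · simp [hl]
    · push Not at hc
      obtain ⟨l, hl, hcl⟩ := hc
      exact Finset.prod_eq_zero (Finset.mem_univ l) (by simp [hl, hcl])
  have h2 : ∀ u : Fin n → ZMod 3,
      ∏ l, (if u l = 0 then (if l ∈ T then 0 else 1) + 2 * (X : ℚ[X])
        else (if l ∈ T then 0 else 1) - X) =
      Polynomial.C (∏ l ∈ T, if u l = 0 then (2 : ℚ) else -1) *
        ((1 + 2 * X) ^ (Tᶜ.filter fun l => u l = 0).card *
        (1 - X) ^ (Tᶜ.filter fun l => u l ≠ 0).card) * X ^ T.card := by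
    intro u
    have e1 : Polynomial.C (∏ l ∈ T, if u l = 0 then (2 : ℚ) else -1) * X ^ T.card =
        ∏ l ∈ T, (if u l = 0 then 2 * (X : ℚ[X]) else -X) := by
      rw [map_prod, ← Finset.prod_const, ← Finset.prod_mul_distrib]
      refine Finset.prod_congr rfl fun l _ => ?_
      have hC : Polynomial.C (2 : ℚ) = 2 := rfl
      split_ifs <;> simp [hC]
    rw [← Finset.prod_mul_prod_compl T, mul_right_comm, e1, ← prod_ite_eq_pow_mul_pow]
    congr 1
    · refine Finset.prod_congr rfl fun l hl => ?_
      simp [hl]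
    · refine Finset.prod_congr rfl fun l hl => ?_
      rw [if_neg (Finset.mem_compl.1 hl)]
  simp only [h1, h2] at h
  rw [← Finset.sum_filter] at h
  have e2 : ((Nat.card C : ℕ) : ℚ[X]) = Polynomial.C ((Nat.card C : ℕ) : ℚ) := by simp
  rw [e2, coeff_C_mul, finsetSum_coeff, finsetSum_coeff] at h
  simp only [coeff_X_pow, coeff_mul_X_pow, coeff_C_mul] at h
  rw [Finset.sum_boole, Finset.filter_filter] at h
  simpa only [kraw, eq_comm (a := k + T.card)] using h

end TernaryDesigns

/-! ### Three weights are determined by three moments -/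

namespace TernaryDesigns

/-- The number of words of weight `w` in a set of words. -/
def countWt {n : ℕ} (S : Finset (Fin n → ZMod 3)) (w : ℕ) : ℕ :=
  (S.filter fun u => hammingNorm u = w).card

theorem weightCount_eq_countWt {n : ℕ} (C : Submodule (ZMod 3) (Fin n → ZMod 3)) (w : ℕ) :
    weightCount C w = countWt (words C) w := by
  rw [weightCount, countWt, ← Set.ncard_coe_finset]
  congr 1
  ext c
  simp [weightSet]

/-- Every nonzero word of `C` has weight `s² - s`, `s²` or `s² + s`. -/
def IsThreeWeight (s : ℕ) {n : ℕ} (C : Submodule (ZMod 3) (Fin n → ZMod 3)) : Prop :=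
  ∀ u ∈ C, u ≠ 0 → hammingNorm u = s ^ 2 - s ∨ hammingNorm u = s ^ 2 ∨ hammingNorm u = s ^ 2 + s

theorem sum_eq_of_three_weights {s n : ℕ} (hs : 0 < s) {S : Finset (Fin n → ZMod 3)}
    (hS : ∀ u ∈ S, hammingNorm u = s ^ 2 - s ∨ hammingNorm u = s ^ 2 ∨
      hammingNorm u = s ^ 2 + s) (f : (Fin n → ZMod 3) → ℚ) :
    ∑ u ∈ S, f u = ∑ u ∈ S with hammingNorm u = s ^ 2 - s, f u +
      ∑ u ∈ S with hammingNorm u = s ^ 2, f u + ∑ u ∈ S with hammingNorm u = s ^ 2 + s, f u := by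
  classical
  have h1 : s ≤ s ^ 2 := Nat.le_self_pow two_ne_zero s
  rw [← Finset.sum_union, ← Finset.sum_union]
  · refine Finset.sum_congr ?_ fun _ _ => rfl
    ext u
    have := hS u
    simp only [Finset.mem_union, Finset.mem_filter]
    tauto
  · rw [Finset.disjoint_left]
    intro u hu hu'
    simp only [Finset.mem_union, Finset.mem_filter] at hu hu'
    omega
  · rw [Finset.disjoint_left]
    intro u hu hu'
    simp only [Finset.mem_filter] at hu hu'
    omega

/-- The bound `2 ≤ s` makes `s ^ 2 - s` positive, so the zero word belongs to none of the three
weight classes. -/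
theorem sum_weight_eq {s n : ℕ} (hs : 2 ≤ s) {S : Finset (Fin n → ZMod 3)} (h0 : 0 ∈ S)
    (hS : ∀ u ∈ S, u ≠ 0 → hammingNorm u = s ^ 2 - s ∨ hammingNorm u = s ^ 2 ∨
      hammingNorm u = s ^ 2 + s) (g : ℕ → ℚ) :
    ∑ u ∈ S, g (hammingNorm u) = g 0 + countWt S (s ^ 2 - s) * g (s ^ 2 - s) +
      countWt S (s ^ 2) * g (s ^ 2) + countWt S (s ^ 2 + s) * g (s ^ 2 + s) := by
  classical
  have h1 : 2 * s ≤ s ^ 2 := by nlinarith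
  have key : ∀ w, 0 < w → ∑ u ∈ S.erase 0 with hammingNorm u = w, g (hammingNorm u) =
      countWt S w * g w := by
    intro w hw
    rw [Finset.sum_congr rfl (g := fun _ => g w) (fun u hu => by rw [(Finset.mem_filter.1 hu).2]),
      Finset.sum_const, nsmul_eq_mul, countWt]
    congr 3
    ext u
    simp only [Finset.mem_filter, Finset.mem_erase, and_assoc, and_iff_right_iff_imp]
    rintro ⟨-, hu⟩ rfl
    simp at hu
    omega
  rw [← Finset.add_sum_erase S _ h0, sum_eq_of_three_weights (s := s) (by omega), key, key, key,
    hammingNorm_zero]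
  · ring
  · omega
  · omega
  · omega
  · exact fun u hu => hS u (Finset.mem_of_mem_erase hu) (Finset.ne_of_mem_erase hu)

/-- The coefficients are Krawtchouk values of degrees 0, 1, 2 at the weights `s² - s`, `s²`, `s² +
s`: a Vandermonde-type system with distinct nodes. In the form of a uniqueness statement, it only
asks that candidate frequencies be verified. -/
theorem moments_solve {s N x y z E0 E1 E2 : ℚ} (hs : s ≠ 0)
    (h0 : 1 + x + y + z = E0)
    (h1 : 2 * N + x * (2 * N - 3 * (s ^ 2 - s)) + y * (2 * N - 3 * s ^ 2) +
      z * (2 * N - 3 * (s ^ 2 + s)) = E1)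
    (h2 : (2 * N ^ 2 - 2 * N) +
      x * (9 / 2 * (s ^ 2 - s) ^ 2 + (3 / 2 - 6 * N) * (s ^ 2 - s) + 2 * N ^ 2 - 2 * N) +
      y * (9 / 2 * (s ^ 2) ^ 2 + (3 / 2 - 6 * N) * s ^ 2 + 2 * N ^ 2 - 2 * N) +
      z * (9 / 2 * (s ^ 2 + s) ^ 2 + (3 / 2 - 6 * N) * (s ^ 2 + s) + 2 * N ^ 2 - 2 * N) = E2)
    {a b c : ℚ} (ha : 1 + a + b + c = E0)
    (hb : 2 * N + a * (2 * N - 3 * (s ^ 2 - s)) + b * (2 * N - 3 * s ^ 2) +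
      c * (2 * N - 3 * (s ^ 2 + s)) = E1)
    (hc : (2 * N ^ 2 - 2 * N) +
      a * (9 / 2 * (s ^ 2 - s) ^ 2 + (3 / 2 - 6 * N) * (s ^ 2 - s) + 2 * N ^ 2 - 2 * N) +
      b * (9 / 2 * (s ^ 2) ^ 2 + (3 / 2 - 6 * N) * s ^ 2 + 2 * N ^ 2 - 2 * N) +
      c * (9 / 2 * (s ^ 2 + s) ^ 2 + (3 / 2 - 6 * N) * (s ^ 2 + s) + 2 * N ^ 2 - 2 * N) = E2) :
    x = a ∧ y = b ∧ z = c := by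
  have d1 : z - x = c - a := by
    apply mul_left_cancel₀ hs
    linear_combination (-1 / 3) * (h1 - hb) + ((2 * N - 3 * s ^ 2) / 3) * (h0 - ha)
  have d2 : x + z = a + c := by
    apply mul_left_cancel₀ (pow_ne_zero 2 hs)
    linear_combination (2 / 9) * (h2 - hc) -
      (s ^ 4 + 2 / 9 * (3 / 2 - 6 * N) * s ^ 2 + 2 / 9 * (2 * N ^ 2 - 2 * N)) * (h0 - ha) -
      (2 * s ^ 3 + 2 / 9 * (3 / 2 - 6 * N) * s) * d1
  refine ⟨by linear_combination (d2 - d1) / 2, by linear_combination h0 - ha - d2,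
    by linear_combination (d2 + d1) / 2⟩

/-- Cases `k = 0, 1, 2` of `macWilliams_puncture` are three linear equations for the words vanishing
on `T`. Thus the low-weight counts of the punctured dual code determine the frequencies. -/
theorem countWt_solve {s n : ℕ} (hs : 2 ≤ s) {C : Submodule (ZMod 3) (Fin n → ZMod 3)}
    (hC : IsThreeWeight s C) (hcard : Nat.card C = 9 * s ^ 4) (T : Finset (Fin n))
    (hT : s ^ 2 + s + T.card ≤ n) {D1 D2 : ℕ}
    (hD0 : ((words (dualCode C)).filter
        fun c => (Tᶜ.filter fun l => c l ≠ 0).card = 0).card = 1)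
    (hD1 : ((words (dualCode C)).filter
        fun c => (Tᶜ.filter fun l => c l ≠ 0).card = 1).card = D1)
    (hD2 : ((words (dualCode C)).filter
        fun c => (Tᶜ.filter fun l => c l ≠ 0).card = 2).card = D2)
    {a b c N : ℚ} (hN : N = n - T.card) (ha : 1 + a + b + c = 9 * s ^ 4 / 3 ^ T.card)
    (hb : 2 * N + a * (2 * N - 3 * (s ^ 2 - s)) + b * (2 * N - 3 * s ^ 2) +
      c * (2 * N - 3 * (s ^ 2 + s)) = 9 * s ^ 4 / 3 ^ T.card * D1)
    (hc : (2 * N ^ 2 - 2 * N) +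
      a * (9 / 2 * (s ^ 2 - s) ^ 2 + (3 / 2 - 6 * N) * (s ^ 2 - s) + 2 * N ^ 2 - 2 * N) +
      b * (9 / 2 * (s ^ 2) ^ 2 + (3 / 2 - 6 * N) * s ^ 2 + 2 * N ^ 2 - 2 * N) +
      c * (9 / 2 * (s ^ 2 + s) ^ 2 + (3 / 2 - 6 * N) * (s ^ 2 + s) + 2 * N ^ 2 - 2 * N) =
        9 * s ^ 4 / 3 ^ T.card * D2) :
    (countWt ((words C).filter fun u => ∀ l ∈ T, u l = 0) (s ^ 2 - s) : ℚ) = a ∧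
    (countWt ((words C).filter fun u => ∀ l ∈ T, u l = 0) (s ^ 2) : ℚ) = b ∧
    (countWt ((words C).filter fun u => ∀ l ∈ T, u l = 0) (s ^ 2 + s) : ℚ) = c := by
  have h3 : (3 : ℚ) ^ T.card ≠ 0 := by positivity
  have hle : s ≤ s ^ 2 := Nat.le_self_pow two_ne_zero s
  have key : ∀ k, 9 * (s : ℚ) ^ 4 / 3 ^ T.card * ((words (dualCode C)).filter
        fun c => (Tᶜ.filter fun l => c l ≠ 0).card = k).card =
      ∑ u ∈ (words C).filter (fun u => ∀ l ∈ T, u l = 0),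
        kraw (n - T.card - hammingNorm u) (hammingNorm u) k := by
    intro k
    have := macWilliams_puncture C T k
    rw [hcard] at this
    push_cast at this
    field_simp
    linear_combination this
  have key' := fun k => (key k).trans (sum_weight_eq (s := s) hs
    (S := (words C).filter (fun u => ∀ l ∈ T, u l = 0)) (by simp)
    (fun u hu => hC u (by simpa using (Finset.mem_filter.1 hu).1))
    fun w => kraw (n - T.card - w) w k)
  have e0 := key' 0
  have e1 := key' 1
  have e2 := key' 2
  have c1 : ((n - T.card - (s ^ 2 - s) : ℕ) : ℚ) = N - (s ^ 2 - s) := by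
    rw [Nat.cast_sub (by omega), Nat.cast_sub (by omega), Nat.cast_sub (by omega), hN]
    push_cast
    ring
  have c2 : ((n - T.card - s ^ 2 : ℕ) : ℚ) = N - s ^ 2 := by
    rw [Nat.cast_sub (by omega), Nat.cast_sub (by omega), hN]
    push_cast
    ring
  have c3 : ((n - T.card - (s ^ 2 + s) : ℕ) : ℚ) = N - (s ^ 2 + s) := by
    rw [Nat.cast_sub (by omega), Nat.cast_sub (by omega), hN]
    push_cast
    ring
  have c4 : ((n - T.card - 0 : ℕ) : ℚ) = N := by
    rw [Nat.cast_sub (by omega), Nat.cast_sub (by omega), hN]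
    push_cast
    ring
  have c5 : ((s ^ 2 - s : ℕ) : ℚ) = s ^ 2 - s := by
    rw [Nat.cast_sub hle]
    push_cast
    ring
  rw [hD0] at e0
  rw [hD1] at e1
  rw [hD2] at e2
  simp only [kraw_zero, kraw_one, kraw_two, c1, c2, c3, c4, c5] at e0 e1 e2
  push_cast at e0 e1 e2
  refine moments_solve (s := s) (N := N) (by positivity) ?_ ?_ ?_ ha hb hc
  · linear_combination -e0
  · linear_combination -e1
  · linear_combination -e2

/-- This is the case `T = ∅`: with dual distance at least 3 the first and second dual counts vanish.
-/
theorem countWt_of_dual {s n : ℕ} (hs : 5 ≤ s) (hn : 2 * n + 1 = 3 * s ^ 2)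
    {C : Submodule (ZMod 3) (Fin n → ZMod 3)}
    (hC : IsThreeWeight s C) (hcard : Nat.card C = 9 * s ^ 4)
    (hdual : ∀ c ∈ dualCode C, c ≠ 0 → 3 ≤ hammingNorm c) :
    (countWt (words C) (s ^ 2 - s) : ℚ) = 1 / 2 * (s ^ 2 + s) * (3 * s ^ 2 - 1) ∧
    (countWt (words C) (s ^ 2) : ℚ) = (2 * s ^ 2 + 1) * (3 * s ^ 2 - 1) ∧
    (countWt (words C) (s ^ 2 + s) : ℚ) = 1 / 2 * (s ^ 2 - s) * (3 * s ^ 2 - 1) := by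
  have hnq : (n : ℚ) = (3 * s ^ 2 - 1) / 2 := by
    have : (2 * n + 1 : ℚ) = 3 * s ^ 2 := by exact_mod_cast hn
    linear_combination this / 2
  have h := countWt_solve (s := s) (by omega) hC hcard ∅ (by simp; nlinarith) (D1 := 0) (D2 := 0)
    ?_ ?_ ?_ rfl (a := 1 / 2 * (s ^ 2 + s) * (3 * s ^ 2 - 1))
    (b := (2 * s ^ 2 + 1) * (3 * s ^ 2 - 1)) (c := 1 / 2 * (s ^ 2 - s) * (3 * s ^ 2 - 1))
    ?_ ?_ ?_
  · simpa using h
  · rw [Finset.card_eq_one]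
    refine ⟨0, ?_⟩
    ext c
    simp only [Finset.compl_empty, Finset.mem_filter, mem_words, Finset.mem_singleton]
    constructor
    · rintro ⟨-, h⟩
      exact hammingNorm_eq_zero.1 h
    · rintro rfl
      simp
  · rw [Finset.card_eq_zero, Finset.filter_eq_empty_iff]
    intro c hc h
    have h' : hammingNorm c = 1 := by rwa [Finset.compl_empty] at h
    have := hdual c (by simpa using hc) (by rintro rfl; simp at h')
    omega
  · rw [Finset.card_eq_zero, Finset.filter_eq_empty_iff]
    intro c hc h
    have h' : hammingNorm c = 2 := by rwa [Finset.compl_empty] at h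
    have := hdual c (by simpa using hc) (by rintro rfl; simp at h')
    omega
  all_goals
    try rw [hnq]
    simp only [Finset.card_empty, pow_zero]
    push_cast
    ring

end TernaryDesigns

/-! ### Low-weight dual words -/

namespace TernaryDesigns

/-- The three-weight distribution written in terms of `s`, with total number of words `9 s⁴`. -/
structure HasDistribution (s : ℕ) {n : ℕ} (C : Submodule (ZMod 3) (Fin n → ZMod 3)) : Prop where
  le : 9 ≤ s
  length : 2 * n + 1 = 3 * s ^ 2
  weights : IsThreeWeight s C
  card : Nat.card C = 9 * s ^ 4
  low : (countWt (words C) (s ^ 2 - s) : ℚ) = 1 / 2 * (s ^ 2 + s) * (3 * s ^ 2 - 1)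
  mid : (countWt (words C) (s ^ 2) : ℚ) = (2 * s ^ 2 + 1) * (3 * s ^ 2 - 1)
  high : (countWt (words C) (s ^ 2 + s) : ℚ) = 1 / 2 * (s ^ 2 - s) * (3 * s ^ 2 - 1)

namespace HasDistribution

variable {s n : ℕ} {C : Submodule (ZMod 3) (Fin n → ZMod 3)}

theorem cast_length (h : HasDistribution s C) : (n : ℚ) = (3 * s ^ 2 - 1) / 2 := by
  have : (2 * n + 1 : ℚ) = 3 * s ^ 2 := by exact_mod_cast h.length
  linear_combination this / 2

theorem add_two_le (h : HasDistribution s C) : s ^ 2 + s + 2 ≤ n := by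
  have := h.le
  have := h.length
  nlinarith

theorem nine_mul_le (h : HasDistribution s C) : 9 * s ≤ s ^ 2 := by
  have := h.le
  nlinarith

theorem card_dual_weight (h : HasDistribution s C) (k : ℕ) :
    9 * (s : ℚ) ^ 4 * countWt (words (dualCode C)) k =
      kraw n 0 k + 1 / 2 * (s ^ 2 + s) * (3 * s ^ 2 - 1) * kraw (n - (s ^ 2 - s)) (s ^ 2 - s) k +
      (2 * s ^ 2 + 1) * (3 * s ^ 2 - 1) * kraw (n - s ^ 2) (s ^ 2) k +
      1 / 2 * (s ^ 2 - s) * (3 * s ^ 2 - 1) * kraw (n - (s ^ 2 + s)) (s ^ 2 + s) k := by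
  have h1 := macWilliams_puncture C ∅ k
  have hle := h.le
  simp only [Finset.compl_empty, Finset.card_empty, Finset.notMem_empty, false_imp_iff,
    imp_true_iff, Finset.filter_true, pow_zero, one_mul, Nat.sub_zero] at h1
  rw [sum_weight_eq (s := s) (by omega) (by simp) (fun u hu => h.weights u (mem_words.1 hu))
    fun w => kraw (n - w) w k, h.card, h.low, h.mid, h.high] at h1
  push_cast at h1
  exact h1

theorem cast_sub (h : HasDistribution s C) :
    ((s ^ 2 - s : ℕ) : ℚ) = s ^ 2 - s ∧
    ((n - (s ^ 2 - s) : ℕ) : ℚ) = (3 * s ^ 2 - 1) / 2 - (s ^ 2 - s) ∧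
    ((n - s ^ 2 : ℕ) : ℚ) = (3 * s ^ 2 - 1) / 2 - s ^ 2 ∧
    ((n - (s ^ 2 + s) : ℕ) : ℚ) = (3 * s ^ 2 - 1) / 2 - (s ^ 2 + s) := by
  have h1 := h.add_two_le
  have h2 := h.nine_mul_le
  have h3 : ((s ^ 2 - s : ℕ) : ℚ) = s ^ 2 - s := by
    rw [Nat.cast_sub (by omega)]
    push_cast
    ring
  refine ⟨h3, ?_, ?_, ?_⟩
  · rw [Nat.cast_sub (by omega), h3, h.cast_length]
  · rw [Nat.cast_sub (by omega), h.cast_length]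
    push_cast
    ring
  · rw [Nat.cast_sub (by omega), h.cast_length]
    push_cast
    ring

theorem countWt_dual_eq_zero (h : HasDistribution s C) {k : ℕ} (hk : k ∈ ({1, 2, 3} : Finset ℕ)) :
    countWt (words (dualCode C)) k = 0 := by
  obtain ⟨h1, h2, h3, h4⟩ := h.cast_sub
  have hs : (9 * (s : ℚ) ^ 4) ≠ 0 := by
    have := h.le
    positivity
  have key := h.card_dual_weight k
  have : (countWt (words (dualCode C)) k : ℚ) = 0 := by
    apply mul_left_cancel₀ hs
    rw [key, mul_zero]
    simp only [Finset.mem_insert, Finset.mem_singleton] at hk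
    rcases hk with rfl | rfl | rfl <;>
    · simp only [kraw_three, kraw_two, kraw_one, h1, h2, h3, h4, h.cast_length]
      push_cast
      ring
  exact_mod_cast this

/-- A word of weight 4 covers six pairs, so the total over pairs is `n (n - 1)`, which is twice the
number of pairs. -/
theorem countWt_dual_four (h : HasDistribution s C) :
    6 * countWt (words (dualCode C)) 4 = n * (n - 1) := by
  obtain ⟨h1, h2, h3, h4⟩ := h.cast_sub
  have hs : (9 * (s : ℚ) ^ 4) ≠ 0 := by
    have := h.le
    positivity
  have hn : 1 ≤ n := by
    have := h.add_two_le
    omega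
  have key := h.card_dual_weight 4
  have : 6 * (countWt (words (dualCode C)) 4 : ℚ) = n * (n - 1 : ℕ) := by
    apply mul_left_cancel₀ hs
    rw [mul_left_comm, key, Nat.cast_sub hn]
    simp only [kraw_four, kraw_three, kraw_two, h1, h2, h3, h4,
      h.cast_length]
    push_cast
    ring
  exact_mod_cast this

theorem four_le (h : HasDistribution s C) {c : Fin n → ZMod 3} (hc : c ∈ dualCode C)
    (h0 : c ≠ 0) : 4 ≤ hammingNorm c := by
  by_contra hlt
  have h1 : hammingNorm c ≠ 0 := hammingNorm_ne_zero_iff.2 h0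
  have h2 : hammingNorm c ∈ ({1, 2, 3} : Finset ℕ) := by
    simp only [Finset.mem_insert, Finset.mem_singleton]
    omega
  have h3 := h.countWt_dual_eq_zero h2
  rw [countWt, Finset.card_eq_zero, Finset.filter_eq_empty_iff] at h3
  exact h3 (mem_words.2 hc) rfl

end HasDistribution

/-- The words of `C` of weight `k` that do not vanish on `T`. -/
noncomputable def wordsOn {n : ℕ} (C : Submodule (ZMod 3) (Fin n → ZMod 3))
    (T : Finset (Fin n)) (k : ℕ) : Finset (Fin n → ZMod 3) :=
  (words C).filter fun c => (∀ l ∈ T, c l ≠ 0) ∧ hammingNorm c = k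

theorem sum_card_wordsOn_pair {n : ℕ} (C : Submodule (ZMod 3) (Fin n → ZMod 3)) (k : ℕ) :
    ∑ T ∈ (Finset.univ : Finset (Fin n)).powersetCard 2, (wordsOn C T k).card =
      k.choose 2 * countWt (words C) k := by
  have h1 := Finset.sum_card_bipartiteAbove_eq_sum_card_bipartiteBelow
    (s := (Finset.univ : Finset (Fin n)).powersetCard 2)
    (t := (words C).filter fun c => hammingNorm c = k) (fun T c => ∀ l ∈ T, c l ≠ 0)
  have h2 : ∀ T, (wordsOn C T k) = ((words C).filter fun c => hammingNorm c = k).bipartiteAbove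
      (fun T c => ∀ l ∈ T, c l ≠ 0) T := by
    intro T
    rw [Finset.bipartiteAbove, Finset.filter_filter, wordsOn]
    exact Finset.filter_congr fun c _ => and_comm
  simp_rw [h2]
  rw [h1, Finset.sum_congr rfl (g := fun _ => k.choose 2), Finset.sum_const, smul_eq_mul,
    mul_comm, countWt]
  intro c hc
  rw [← (Finset.mem_filter.1 hc).2, hammingNorm, ← Finset.card_powersetCard]
  congr 1
  ext T
  simp only [Finset.mem_bipartiteBelow, Finset.mem_powersetCard, Finset.subset_univ, true_and]
  rw [and_comm]
  refine and_congr ?_ Iff.rfl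
  simp [Finset.subset_iff]

/-- The average over pairs is exactly 2, so a pointwise lower bound of 2 must be an equality
everywhere. -/
theorem HasDistribution.card_wordsOn_four {s n : ℕ} {C : Submodule (ZMod 3) (Fin n → ZMod 3)}
    (h : HasDistribution s C) (hline : ∀ T : Finset (Fin n), T.card = 2 →
      2 ≤ (wordsOn (dualCode C) T 4).card) {T : Finset (Fin n)} (hT : T.card = 2) :
    (wordsOn (dualCode C) T 4).card = 2 := by
  have h1 := sum_card_wordsOn_pair (dualCode C) 4
  have h2 : ∑ T ∈ (Finset.univ : Finset (Fin n)).powersetCard 2, 2 =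
      ∑ T ∈ (Finset.univ : Finset (Fin n)).powersetCard 2, (wordsOn (dualCode C) T 4).card := by
    rw [h1, Finset.sum_const, Finset.card_powersetCard, Finset.card_univ, Fintype.card_fin,
      smul_eq_mul, show Nat.choose 4 2 = 6 from rfl, h.countWt_dual_four, Nat.choose_two_right,
      Nat.div_two_mul_two_of_even (Nat.even_mul_pred_self n)]
  have h3 := (Finset.sum_eq_sum_iff_of_le fun T hT =>
    hline T (Finset.mem_powersetCard.1 hT).2).1 h2
  exact (h3 T (by simp [Finset.mem_powersetCard, hT])).symm

end TernaryDesigns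

/-! ### Words vanishing at one or two points, and dual words through a pair -/

namespace TernaryDesigns

theorem hammingNorm_eq_card_add_card {n : ℕ} (T : Finset (Fin n)) (c : Fin n → ZMod 3) :
    hammingNorm c =
      (T.filter fun l => c l ≠ 0).card + (Tᶜ.filter fun l => c l ≠ 0).card := by
  rw [hammingNorm, ← Finset.card_union_of_disjoint, ← Finset.filter_union,
    Finset.union_compl]
  exact Finset.disjoint_filter_filter disjoint_compl_right

theorem sum_ite_ite {α : Type*} (S : Finset α) (p q : α → Prop) [DecidablePred p]
    [DecidablePred q] (P0 P1 P2 : ℚ) :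
    ∑ u ∈ S, (if p u then if q u then P0 else P1 else if q u then P1 else P2) =
      (S.filter fun u => p u ∧ q u).card * (P0 - 2 * P1 + P2) +
      (S.filter p).card * (P1 - P2) + (S.filter q).card * (P1 - P2) + S.card * P2 := by
  have h1 : ∀ u, (if p u then if q u then P0 else P1 else if q u then P1 else P2) =
      (if p u ∧ q u then (P0 - 2 * P1 + P2) else 0) + (if p u then P1 - P2 else 0) +
      (if q u then P1 - P2 else 0) + P2 := by
    intro u
    by_cases hp : p u <;> by_cases hq : q u <;> (simp [hp, hq]; try ring)
  simp_rw [h1]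
  simp only [Finset.sum_add_distrib, ← Finset.sum_filter, Finset.sum_const, nsmul_eq_mul]
  ring

namespace HasDistribution

variable {s n : ℕ} {C : Submodule (ZMod 3) (Fin n → ZMod 3)}

theorem card_punctured_zero (h : HasDistribution s C) {T : Finset (Fin n)} (hT : T.card ≤ 2) :
    ((words (dualCode C)).filter
        fun c => (Tᶜ.filter fun l => c l ≠ 0).card = 0).card = 1 := by
  rw [Finset.card_eq_one]
  refine ⟨0, ?_⟩
  ext c
  simp only [Finset.mem_filter, mem_words, Finset.mem_singleton]
  constructor
  · rintro ⟨hc, h1⟩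
    by_contra h0
    have := h.four_le hc h0
    rw [hammingNorm_eq_card_add_card T, h1] at this
    have := Finset.card_filter_le T fun l => c l ≠ 0
    omega
  · rintro rfl
    simp

theorem card_punctured_eq_zero (h : HasDistribution s C) {T : Finset (Fin n)} {k : ℕ}
    (hk : 0 < k) (hT : T.card + k < 4) :
    ((words (dualCode C)).filter
        fun c => (Tᶜ.filter fun l => c l ≠ 0).card = k).card = 0 := by
  rw [Finset.card_eq_zero, Finset.filter_eq_empty_iff]
  intro c hc h1
  have h0 : c ≠ 0 := by
    rintro rfl
    simp at h1
    omega
  have := h.four_le (mem_words.1 hc) h0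
  rw [hammingNorm_eq_card_add_card T, h1] at this
  have := Finset.card_filter_le T fun l => c l ≠ 0
  omega

/-- Deleting two coordinates removes at most two from the weight, and dual weights are at least 4;
so weight 2 remains only when both deleted entries are nonzero and the weight was 4. -/
theorem card_punctured_two (h : HasDistribution s C) {T : Finset (Fin n)} (hT : T.card = 2) :
    ((words (dualCode C)).filter fun c => (Tᶜ.filter fun l => c l ≠ 0).card = 2) =
      wordsOn (dualCode C) T 4 := by
  refine Finset.filter_congr fun c hc => ?_
  have h2 := Finset.card_filter_le T fun l => c l ≠ 0
  have h3 := hammingNorm_eq_card_add_card T c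
  have h4 : (∀ l ∈ T, c l ≠ 0) ↔ (T.filter fun l => c l ≠ 0).card = T.card :=
    Finset.card_filter_eq_iff.symm
  rw [h4]
  constructor
  · intro h1
    have h0 : c ≠ 0 := by
      rintro rfl
      simp at h1
    have := h.four_le (mem_words.1 hc) h0
    omega
  · omega

theorem shortened_one (h : HasDistribution s C) (i : Fin n) :
    (countWt ((words C).filter fun u => u i = 0) (s ^ 2 - s) : ℚ) =
      -1 / 2 * s + 1 / 2 * s ^ 2 + 3 / 2 * s ^ 3 + 1 / 2 * s ^ 4 ∧
    (countWt ((words C).filter fun u => u i = 0) (s ^ 2) : ℚ) = -1 - s ^ 2 + 2 * s ^ 4 ∧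
    (countWt ((words C).filter fun u => u i = 0) (s ^ 2 + s) : ℚ) =
      1 / 2 * s + 1 / 2 * s ^ 2 - 3 / 2 * s ^ 3 + 1 / 2 * s ^ 4 := by
  have h1 := h.le
  have h2 := h.add_two_le
  have key := countWt_solve (s := s) (by omega) h.weights h.card {i} (by simp; omega)
    (h.card_punctured_zero (by simp)) (h.card_punctured_eq_zero one_pos (by simp))
    (h.card_punctured_eq_zero two_pos (by simp)) rfl
    (a := -1 / 2 * s + 1 / 2 * s ^ 2 + 3 / 2 * s ^ 3 + 1 / 2 * s ^ 4)
    (b := -1 - s ^ 2 + 2 * s ^ 4)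
    (c := 1 / 2 * s + 1 / 2 * s ^ 2 - 3 / 2 * s ^ 3 + 1 / 2 * s ^ 4) ?_ ?_ ?_
  · simpa using key
  all_goals
    try rw [h.cast_length]
    rw [Finset.card_singleton]
    push_cast
    ring

/-- The pair `T` enters the moment equations only through the number of dual words of weight 4 on
it. Hence the frequencies are the same for all pairs, which is the source of the design property. -/
theorem shortened_two (h : HasDistribution s C) {T : Finset (Fin n)} (hT : T.card = 2)
    (h4 : (wordsOn (dualCode C) T 4).card = 2) :
    (countWt ((words C).filter fun u => ∀ l ∈ T, u l = 0) (s ^ 2 - s) : ℚ) =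
      -1 / 2 * s + 5 / 6 * s ^ 2 + 5 / 6 * s ^ 3 + 1 / 6 * s ^ 4 ∧
    (countWt ((words C).filter fun u => ∀ l ∈ T, u l = 0) (s ^ 2) : ℚ) =
      -1 - 5 / 3 * s ^ 2 + 2 / 3 * s ^ 4 ∧
    (countWt ((words C).filter fun u => ∀ l ∈ T, u l = 0) (s ^ 2 + s) : ℚ) =
      1 / 2 * s + 5 / 6 * s ^ 2 - 5 / 6 * s ^ 3 + 1 / 6 * s ^ 4 := by
  have h1 := h.le
  have h2 := h.add_two_le
  refine countWt_solve (s := s) (by omega) h.weights h.card T (by omega)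
    (h.card_punctured_zero (by omega)) (h.card_punctured_eq_zero one_pos (by omega))
    ((congrArg Finset.card (h.card_punctured_two hT)).trans h4) rfl ?_ ?_ ?_
  all_goals
    try rw [h.cast_length]
    rw [hT]
    push_cast
    ring

/-- In `macWilliams_support` a word of `C` contributes according to its weight and its zero pattern
at `i` and `j`, with local factors 4, -2 or 1. Inclusion–exclusion expresses the pattern counts by
the frequencies of `shortened_one`, `shortened_two` and the whole code. -/
theorem card_wordsOn_eq (h : HasDistribution s C) {i j : Fin n} (hij : i ≠ j)
    (h4 : (wordsOn (dualCode C) {i, j} 4).card = 2) (k : ℕ) :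
    9 * (s : ℚ) ^ 4 * (wordsOn (dualCode C) {i, j} (k + 2)).card =
      4 * kraw (n - 2) 0 k +
      ((-1 / 2 * s + 5 / 6 * s ^ 2 + 5 / 6 * s ^ 3 + 1 / 6 * s ^ 4) *
        (4 * kraw (n - (s ^ 2 - s) - 2) (s ^ 2 - s) k +
          4 * kraw (n - (s ^ 2 - s) - 1) (s ^ 2 - s - 1) k +
          kraw (n - (s ^ 2 - s)) (s ^ 2 - s - 2) k) -
      2 * (-1 / 2 * s + 1 / 2 * s ^ 2 + 3 / 2 * s ^ 3 + 1 / 2 * s ^ 4) *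
        (2 * kraw (n - (s ^ 2 - s) - 1) (s ^ 2 - s - 1) k +
          kraw (n - (s ^ 2 - s)) (s ^ 2 - s - 2) k) +
      1 / 2 * (s ^ 2 + s) * (3 * s ^ 2 - 1) * kraw (n - (s ^ 2 - s)) (s ^ 2 - s - 2) k) +
      ((-1 - 5 / 3 * s ^ 2 + 2 / 3 * s ^ 4) *
        (4 * kraw (n - s ^ 2 - 2) (s ^ 2) k + 4 * kraw (n - s ^ 2 - 1) (s ^ 2 - 1) k +
          kraw (n - s ^ 2) (s ^ 2 - 2) k) -
      2 * (-1 - s ^ 2 + 2 * s ^ 4) *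
        (2 * kraw (n - s ^ 2 - 1) (s ^ 2 - 1) k + kraw (n - s ^ 2) (s ^ 2 - 2) k) +
      (2 * s ^ 2 + 1) * (3 * s ^ 2 - 1) * kraw (n - s ^ 2) (s ^ 2 - 2) k) +
      ((1 / 2 * s + 5 / 6 * s ^ 2 - 5 / 6 * s ^ 3 + 1 / 6 * s ^ 4) *
        (4 * kraw (n - (s ^ 2 + s) - 2) (s ^ 2 + s) k +
          4 * kraw (n - (s ^ 2 + s) - 1) (s ^ 2 + s - 1) k +
          kraw (n - (s ^ 2 + s)) (s ^ 2 + s - 2) k) -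
      2 * (1 / 2 * s + 1 / 2 * s ^ 2 - 3 / 2 * s ^ 3 + 1 / 2 * s ^ 4) *
        (2 * kraw (n - (s ^ 2 + s) - 1) (s ^ 2 + s - 1) k +
          kraw (n - (s ^ 2 + s)) (s ^ 2 + s - 2) k) +
      1 / 2 * (s ^ 2 - s) * (3 * s ^ 2 - 1) * kraw (n - (s ^ 2 + s)) (s ^ 2 + s - 2) k) := by
  have hle := h.le
  have hle2 := h.nine_mul_le
  have hT : ({i, j} : Finset (Fin n)).card = 2 := Finset.card_pair hij
  have key := macWilliams_support C {i, j} k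
  rw [hT] at key
  have hf : ∀ u : Fin n → ZMod 3, (∏ l ∈ {i, j}, if u l = 0 then (2 : ℚ) else -1) *
      kraw (({i, j} : Finset (Fin n))ᶜ.filter fun l => u l = 0).card
        (({i, j} : Finset (Fin n))ᶜ.filter fun l => u l ≠ 0).card k =
      if u i = 0 then
        if u j = 0 then 4 * kraw (n - hammingNorm u - 2) (hammingNorm u) k
        else -2 * kraw (n - hammingNorm u - 1) (hammingNorm u - 1) k
      else if u j = 0 then -2 * kraw (n - hammingNorm u - 1) (hammingNorm u - 1) k
        else kraw (n - hammingNorm u) (hammingNorm u - 2) k := by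
    intro u
    have h1 := hammingNorm_eq_card_add_card {i, j} u
    have h2 := Finset.card_filter_add_card_filter_not
      (s := ({i, j} : Finset (Fin n))ᶜ) fun l => u l = 0
    rw [Finset.card_compl, Fintype.card_fin, hT] at h2
    have h2' : (({i, j} : Finset (Fin n))ᶜ.filter fun l => u l = 0).card +
      (({i, j} : Finset (Fin n))ᶜ.filter fun l => u l ≠ 0).card = n - 2 := h2
    rw [Finset.prod_pair hij]
    have h5 : (({i, j} : Finset (Fin n)).filter fun l => u l ≠ 0).card =
        (if u i ≠ 0 then 1 else 0) + if u j ≠ 0 then 1 else 0 := by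
      rw [Finset.card_filter, Finset.sum_pair hij]
    rw [h5] at h1
    clear h2 h5
    revert h1 h2'
    generalize (({i, j} : Finset (Fin n))ᶜ.filter fun l => u l = 0).card = Z
    generalize (({i, j} : Finset (Fin n))ᶜ.filter fun l => u l ≠ 0).card = M
    intro h1 h2
    by_cases hi : u i = 0 <;> by_cases hj : u j = 0 <;>
      simp only [hi, hj, ne_eq, not_true_eq_false, not_false_eq_true, if_true, if_false] at h1 ⊢ <;>
      first
      | rw [show (-1 : ℚ) * -1 = 1 by norm_num, one_mul]; congr 1 <;> omega
      | congr 1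
        · norm_num
        · congr 1 <;> omega
  have hz : ∀ w, 0 < w → ((words C).erase 0).filter (fun u => hammingNorm u = w) =
      (words C).filter fun u => hammingNorm u = w := by
    intro w hw
    ext u
    simp only [Finset.mem_filter, Finset.mem_erase, and_assoc, and_iff_right_iff_imp]
    rintro ⟨-, hu⟩ rfl
    simp at hu
    omega
  have hsplit : ∀ (w : ℕ) (P0 P1 P2 : ℚ), ∑ u ∈ (words C).filter (fun u => hammingNorm u = w),
      (if u i = 0 then if u j = 0 then P0 else P1 else if u j = 0 then P1 else P2) =
      countWt ((words C).filter fun u => ∀ l ∈ ({i, j} : Finset (Fin n)), u l = 0) w *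
        (P0 - 2 * P1 + P2) +
      countWt ((words C).filter fun u => u i = 0) w * (P1 - P2) +
      countWt ((words C).filter fun u => u j = 0) w * (P1 - P2) + countWt (words C) w * P2 := by
    intro w P0 P1 P2
    rw [sum_ite_ite]
    simp only [countWt, Finset.filter_filter]
    have e1 : ((words C).filter fun u => hammingNorm u = w ∧ u i = 0 ∧ u j = 0) =
        (words C).filter fun u => (∀ l ∈ ({i, j} : Finset (Fin n)), u l = 0) ∧
          hammingNorm u = w :=
      Finset.filter_congr fun u _ => by simp [and_comm]
    have e2 : ∀ i, ((words C).filter fun u => hammingNorm u = w ∧ u i = 0) =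
        (words C).filter fun u => u i = 0 ∧ hammingNorm u = w :=
      fun i => Finset.filter_congr fun u _ => and_comm
    rw [e1, e2, e2]
  have hsum : ∀ w, ∑ u ∈ (words C).filter (fun u => hammingNorm u = w),
      (if u i = 0 then
        if u j = 0 then 4 * kraw (n - hammingNorm u - 2) (hammingNorm u) k
        else -2 * kraw (n - hammingNorm u - 1) (hammingNorm u - 1) k
      else if u j = 0 then -2 * kraw (n - hammingNorm u - 1) (hammingNorm u - 1) k
        else kraw (n - hammingNorm u) (hammingNorm u - 2) k) =
      ∑ u ∈ (words C).filter (fun u => hammingNorm u = w),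
      (if u i = 0 then if u j = 0 then 4 * kraw (n - w - 2) w k
        else -2 * kraw (n - w - 1) (w - 1) k
      else if u j = 0 then -2 * kraw (n - w - 1) (w - 1) k
        else kraw (n - w) (w - 2) k) :=
    fun w => Finset.sum_congr rfl fun u hu => by rw [(Finset.mem_filter.1 hu).2]
  simp_rw [hf] at key
  rw [← Finset.add_sum_erase _ _ (show (0 : Fin n → ZMod 3) ∈ words C by simp),
    sum_eq_of_three_weights (s := s) (by omega), hz _ (by omega), hz _ (by omega),
    hz _ (by omega), hsum, hsum, hsum, hsplit, hsplit, hsplit, h.low, h.mid, h.high,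
    (h.shortened_one i).1, (h.shortened_one i).2.1, (h.shortened_one i).2.2,
    (h.shortened_one j).1, (h.shortened_one j).2.1, (h.shortened_one j).2.2,
    (h.shortened_two hT h4).1, (h.shortened_two hT h4).2.1, (h.shortened_two hT h4).2.2,
    h.card] at key
  · simp only [Pi.zero_apply, if_true, hammingNorm_zero, Nat.sub_zero] at key
    push_cast at key
    rw [wordsOn]
    linear_combination key
  · exact fun u hu => h.weights u (mem_words.1 (Finset.mem_of_mem_erase hu))
      (Finset.ne_of_mem_erase hu)

end HasDistribution
end TernaryDesigns

/-! ### Evaluating the block counts -/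

namespace TernaryDesigns

/-- The number of blocks of weight `k` through two points, in terms of `s`. -/
def lambdaOf (s : ℚ) : ℕ → ℚ
  | 4 => 1
  | 5 => s ^ 2 - 9
  | 6 => 3 / 4 * (s ^ 4 - 38 / 3 * s ^ 2 + 53)
  | 7 => 3 / 20 * (3 * s ^ 6 - 45 * s ^ 4 + 1006 / 3 * s ^ 2 - 1000)
  | _ => 0

/-- Positivity is what shows that the design has blocks. -/
theorem lambdaOf_pos {s : ℚ} (hs : 9 ≤ s) {k : ℕ} (hk : k ∈ ({4, 5, 6, 7} : Finset ℕ)) :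
    0 < lambdaOf s k := by
  have h2 : 81 ≤ s ^ 2 := by nlinarith
  have h4 : 81 * s ^ 2 ≤ s ^ 4 := by nlinarith [sq_nonneg s]
  have h6 : 81 * s ^ 4 ≤ s ^ 6 := by nlinarith [sq_nonneg (s ^ 2)]
  simp only [Finset.mem_insert, Finset.mem_singleton] at hk
  rcases hk with rfl | rfl | rfl | rfl <;> simp only [lambdaOf] <;> linarith

theorem cast_sub_sub {n w : ℕ} (h2 : 2 ≤ w) (hn : w + 2 ≤ n) :
    ((n - w - 2 : ℕ) : ℚ) = n - w - 2 ∧ ((n - w - 1 : ℕ) : ℚ) = n - w - 1 ∧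
    ((n - w : ℕ) : ℚ) = n - w ∧ ((w - 1 : ℕ) : ℚ) = w - 1 ∧ ((w - 2 : ℕ) : ℚ) = w - 2 := by
  refine ⟨?_, ?_, ?_, ?_, ?_⟩
  · rw [Nat.cast_sub (by omega), Nat.cast_sub (by omega)]; rfl
  · rw [Nat.cast_sub (by omega), Nat.cast_sub (by omega)]; simp
  · rw [Nat.cast_sub (by omega)]
  · rw [Nat.cast_sub (by omega)]; simp
  · rw [Nat.cast_sub (by omega)]; rfl

theorem HasDistribution.card_wordsOn {s n : ℕ} {C : Submodule (ZMod 3) (Fin n → ZMod 3)}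
    (h : HasDistribution s C) {i j : Fin n} (hij : i ≠ j)
    (h4 : (wordsOn (dualCode C) {i, j} 4).card = 2) {k : ℕ}
    (hk : k ∈ ({4, 5, 6, 7} : Finset ℕ)) :
    ((wordsOn (dualCode C) {i, j} k).card : ℚ) = 2 * lambdaOf s k := by
  have hle := h.le
  have hle2 := h.nine_mul_le
  have hle3 := h.add_two_le
  have hs : (9 * (s : ℚ) ^ 4) ≠ 0 := by positivity
  obtain ⟨a1, a2, a3, a4, a5⟩ := cast_sub_sub (n := n) (w := s ^ 2 - s) (by omega) (by omega)
  obtain ⟨b1, b2, b3, b4, b5⟩ := cast_sub_sub (n := n) (w := s ^ 2) (by omega) (by omega)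
  obtain ⟨c1, c2, c3, c4, c5⟩ := cast_sub_sub (n := n) (w := s ^ 2 + s) (by omega) (by omega)
  have d1 : ((n - 2 : ℕ) : ℚ) = n - 2 := by
    rw [Nat.cast_sub (by omega)]
    rfl
  have d2 : ((s ^ 2 : ℕ) : ℚ) = s ^ 2 := by push_cast; rfl
  have d3 : ((s ^ 2 + s : ℕ) : ℚ) = s ^ 2 + s := by push_cast; rfl
  apply mul_left_cancel₀ hs
  simp only [Finset.mem_insert, Finset.mem_singleton] at hk
  rcases hk with rfl | rfl | rfl | rfl
  · rw [h4]
    simp [lambdaOf]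
  · rw [h.card_wordsOn_eq hij h4 3]
    simp only [kraw_three, kraw_two, a1, a2, a3, a4, a5, b1, b2, b3, b4, b5, c1, c2, c3, c4, c5,
      d1, d2, d3, h.cast_sub.1, h.cast_length, Nat.cast_zero, lambdaOf]
    ring
  · rw [h.card_wordsOn_eq hij h4 4]
    simp only [kraw_four, kraw_three, kraw_two, a1, a2, a3, a4, a5, b1, b2, b3, b4, b5, c1, c2,
      c3, c4, c5, d1, d2, d3, h.cast_sub.1, h.cast_length, Nat.cast_zero, lambdaOf]
    ring
  · rw [h.card_wordsOn_eq hij h4 5]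
    simp only [kraw_five, kraw_four, kraw_three, kraw_two, a1, a2, a3, a4, a5, b1, b2, b3, b4, b5,
      c1, c2, c3, c4, c5, d1, d2, d3, h.cast_sub.1, h.cast_length, Nat.cast_zero, lambdaOf]
    ring

end TernaryDesigns

/-! ### From dual words to supports, and from `m` to `s` -/

namespace TernaryDesigns

theorem mem_supp {n : ℕ} {c : Fin n → ZMod 3} {i : Fin n} : i ∈ supp c ↔ c i ≠ 0 := by
  simp [supp]

theorem card_supp {n : ℕ} (c : Fin n → ZMod 3) : (supp c).card = hammingNorm c := rfl

/-- At each point of the common support `d i = ± c i`, so exactly one of `c - d` and `c + d` is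
nonzero there. -/
theorem hammingNorm_sub_add_hammingNorm_add {n : ℕ} {c d : Fin n → ZMod 3}
    (h : supp c = supp d) : hammingNorm (c - d) + hammingNorm (c + d) = hammingNorm c := by
  simp only [hammingNorm, Finset.card_filter]
  rw [← Finset.sum_add_distrib]
  refine Finset.sum_congr rfl fun i _ => ?_
  have hi : c i ≠ 0 ↔ d i ≠ 0 := by rw [← mem_supp, ← mem_supp, h]
  have key : ∀ a b : ZMod 3, (a ≠ 0 ↔ b ≠ 0) →
      ((if a - b ≠ 0 then 1 else 0) + if a + b ≠ 0 then 1 else 0) = if a ≠ 0 then 1 else 0 := by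
    decide
  simpa only [Pi.sub_apply, Pi.add_apply] using key _ _ hi

/-- If both `c - d` and `c + d` were nonzero, their weights would sum to at least 8. This is where
the restriction to weights up to 7 enters. -/
theorem eq_or_eq_neg_of_supp_eq {n : ℕ} {D : Submodule (ZMod 3) (Fin n → ZMod 3)}
    (hD : ∀ c ∈ D, c ≠ 0 → 4 ≤ hammingNorm c) {c d : Fin n → ZMod 3} (hc : c ∈ D) (hd : d ∈ D)
    (h : supp c = supp d) (h7 : hammingNorm c ≤ 7) : c = d ∨ c = -d := by
  by_contra! hne
  have h1 := hD _ (sub_mem hc hd) (sub_ne_zero.2 hne.1)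
  have h2 := hD _ (add_mem hc hd) fun h0 => hne.2 (eq_neg_of_add_eq_zero_left h0)
  have := hammingNorm_sub_add_hammingNorm_add h
  omega

theorem supp_neg {n : ℕ} (c : Fin n → ZMod 3) : supp (-c) = supp c := by
  simp [supp]

theorem two_mul_ncard_blocks {n : ℕ} {D : Submodule (ZMod 3) (Fin n → ZMod 3)}
    (hD : ∀ c ∈ D, c ≠ 0 → 4 ≤ hammingNorm c) {k : ℕ} (hk0 : 0 < k) (hk : k ≤ 7)
    (T : Finset (Fin n)) :
    2 * {b ∈ blocks D k | T ⊆ b}.ncard = (wordsOn D T k).card := by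
  have h1 : {b ∈ blocks D k | T ⊆ b} = ((wordsOn D T k).image supp : Finset (Finset (Fin n))) := by
    ext b
    simp only [blocks, weightSet, Set.mem_ofPred_eq, Set.mem_image, Finset.coe_image,
      Finset.mem_coe, wordsOn, Finset.mem_filter, mem_words]
    constructor
    · rintro ⟨⟨c, ⟨hc, hw⟩, rfl⟩, hT⟩
      exact ⟨c, ⟨hc, fun l hl => mem_supp.1 (hT hl), hw⟩, rfl⟩
    · rintro ⟨c, ⟨hc, hT, hw⟩, rfl⟩
      exact ⟨⟨c, ⟨hc, hw⟩, rfl⟩, fun l hl => mem_supp.2 (hT l hl)⟩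
  rw [h1, Set.ncard_coe_finset, Finset.card_eq_sum_card_image supp (wordsOn D T k),
    Finset.sum_congr rfl (g := fun _ => 2), Finset.sum_const, smul_eq_mul, mul_comm]
  intro b hb
  obtain ⟨c, hc, rfl⟩ := Finset.mem_image.1 hb
  simp only [wordsOn, Finset.mem_filter, mem_words] at hc
  have hc0 : c ≠ 0 := by
    rintro rfl
    simp at hc
    omega
  rw [Finset.card_eq_two]
  refine ⟨c, -c, ?_, ?_⟩
  · intro h
    apply hc0
    ext i
    have hi := congrFun h i
    rw [Pi.neg_apply] at hi
    rw [Pi.zero_apply]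
    revert hi
    generalize c i = a
    revert a
    decide
  · ext d
    simp only [wordsOn, Finset.mem_filter, mem_words, Finset.mem_insert, Finset.mem_singleton]
    constructor
    · rintro ⟨⟨hd, -, hw⟩, hs⟩
      exact eq_or_eq_neg_of_supp_eq hD hd hc.1 hs (hw.trans_le hk)
    · rintro (rfl | rfl)
      · exact ⟨hc, rfl⟩
      · refine ⟨⟨neg_mem hc.1, fun l hl => by simpa using hc.2.1 l hl, ?_⟩, supp_neg c⟩
        rw [← hc.2.2, ← card_supp, ← card_supp, supp_neg]

theorem two_mul_half {m : ℕ} (hodd : Odd m) : 2 * ((m - 1) / 2) + 1 = m := by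
  obtain ⟨r, rfl⟩ := hodd
  omega

theorem three_pow_eq {m : ℕ} (hodd : Odd m) : 3 ^ m = 3 * (3 ^ ((m - 1) / 2)) ^ 2 := by
  rw [← pow_mul, ← pow_succ', mul_comm, two_mul_half hodd]

theorem three_pow_sub_one_eq {m : ℕ} (hodd : Odd m) : 3 ^ (m - 1) = (3 ^ ((m - 1) / 2)) ^ 2 := by
  rw [← pow_mul]
  congr 1
  have := two_mul_half hodd
  omega

theorem two_mul_length {m : ℕ} (hodd : Odd m) :
    2 * ((3 ^ m - 1) / 2) + 1 = 3 * (3 ^ ((m - 1) / 2)) ^ 2 := by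
  rw [← three_pow_eq hodd]
  have h : Odd (3 ^ m) := Odd.pow (by decide)
  obtain ⟨r, hr⟩ := h
  omega

theorem nine_le {m : ℕ} (hm : 5 ≤ m) : 9 ≤ 3 ^ ((m - 1) / 2) := by
  calc 9 = 3 ^ 2 := rfl
    _ ≤ _ := Nat.pow_le_pow_right (by norm_num) (by omega)

theorem lambdaDual_eq {m : ℕ} (hm : 5 ≤ m) (hodd : Odd m) {k : ℕ}
    (hk : k ∈ ({4, 5, 6, 7} : Finset ℕ)) :
    lambdaDual m k = lambdaOf ((3 ^ ((m - 1) / 2) : ℕ) : ℚ) k := by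
  have h1 : m = 2 * ((m - 1) / 2) + 1 := (two_mul_half hodd).symm
  generalize (m - 1) / 2 = r at h1
  subst h1
  have e1 : 2 * r + 1 - 1 = r * 2 := by omega
  have e2 : 2 * (2 * r + 1) - 2 = r * 4 := by omega
  have e3 : 2 * (2 * r + 1) = r * 4 + 2 := by omega
  have e4 : 3 * (2 * r + 1) - 2 = r * 6 + 1 := by omega
  have e5 : (3 : ℚ) ^ (2 * r + 1 - 2) = (3 ^ r) ^ 2 / 3 := by
    rw [eq_div_iff (by norm_num), ← pow_succ, ← pow_mul]
    congr 1
    omega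
  simp only [Finset.mem_insert, Finset.mem_singleton] at hk
  rcases hk with rfl | rfl | rfl | rfl <;> simp only [lambdaDual, lambdaOf]
  · rw [e1, pow_mul]
    push_cast
    rfl
  · rw [e5, e2, pow_mul]
    push_cast
    ring
  · rw [e5, e3, e4, pow_succ, pow_add, pow_mul, pow_mul]
    push_cast
    ring

theorem dualHoldsDesigns_of_distribution {m : ℕ} (hm : 5 ≤ m) (hodd : Odd m)
    {C : Submodule (ZMod 3) (Fin ((3 ^ m - 1) / 2) → ZMod 3)}
    (h : HasDistribution (3 ^ ((m - 1) / 2)) C)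
    (hline : ∀ T : Finset (Fin ((3 ^ m - 1) / 2)), T.card = 2 →
      2 ≤ (wordsOn (dualCode C) T 4).card) : DualHoldsDesigns m C := by
  intro k hk
  have hk' : 4 ≤ k ∧ k ≤ 7 := by
    simp only [Finset.mem_insert, Finset.mem_singleton] at hk
    omega
  have hn := h.add_two_le
  have hle := h.nine_mul_le
  have hs := h.le
  have key : ∀ T : Finset (Fin ((3 ^ m - 1) / 2)), T.card = 2 →
      ({b ∈ blocks (dualCode C) k | T ⊆ b}.ncard : ℚ) = lambdaDual m k := by
    intro T hT
    have h4 := h.card_wordsOn_four hline hT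
    have h1 := two_mul_ncard_blocks (fun c hc => h.four_le hc) (by omega : 0 < k) hk'.2 T
    obtain ⟨i, j, hij, rfl⟩ := Finset.card_eq_two.1 hT
    have h2 := h.card_wordsOn hij h4 hk
    rw [← h1] at h2
    push_cast at h2
    rw [lambdaDual_eq hm hodd hk]
    push_cast
    linarith
  obtain ⟨T₀, -, hT₀⟩ := Finset.exists_subset_card_eq
    (s := (Finset.univ : Finset (Fin ((3 ^ m - 1) / 2)))) (n := 2) (by simp; omega)
  refine ⟨{b ∈ blocks (dualCode C) k | T₀ ⊆ b}.ncard, key T₀ hT₀, ?_⟩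
  refine ⟨by simp, by norm_num, by omega, by omega, ?_, ?_, ?_⟩
  · have h1 := key T₀ hT₀
    have h2 : 0 < lambdaDual m k := by
      rw [lambdaDual_eq hm hodd hk]
      exact lambdaOf_pos (by exact_mod_cast hs) hk
    rw [← h1, Nat.cast_pos] at h2
    obtain ⟨b, hb⟩ := Set.nonempty_of_ncard_ne_zero h2.ne'
    exact ⟨b, hb.1⟩
  · rintro b ⟨c, hc, rfl⟩
    exact (card_supp c).trans hc.2
  · intro T hT
    have := (key T hT).trans (key T₀ hT₀).symm
    exact_mod_cast this

theorem HasThreeWeightDistribution.hasDistribution {m : ℕ} (hm : 5 ≤ m) (hodd : Odd m)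
    {C : Submodule (ZMod 3) (Fin ((3 ^ m - 1) / 2) → ZMod 3)}
    (h : HasThreeWeightDistribution m C) : HasDistribution (3 ^ ((m - 1) / 2)) C := by
  have hs := nine_le hm
  have hlen := two_mul_length hodd
  have hp := three_pow_eq hodd
  have hp1 := three_pow_sub_one_eq hodd
  have hle2 : 9 * 3 ^ ((m - 1) / 2) ≤ (3 ^ ((m - 1) / 2)) ^ 2 := by nlinarith
  have hpq : (3 : ℚ) ^ m = 3 * ((3 ^ ((m - 1) / 2) : ℕ) : ℚ) ^ 2 := by exact_mod_cast hp
  have hp1q : (3 : ℚ) ^ (m - 1) = ((3 ^ ((m - 1) / 2) : ℕ) : ℚ) ^ 2 := by exact_mod_cast hp1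
  have hsq : (3 : ℚ) ^ ((m - 1) / 2) = ((3 ^ ((m - 1) / 2) : ℕ) : ℚ) := by push_cast; rfl
  unfold HasThreeWeightDistribution threeWeightFreq at h
  simp only [hpq, hp1q, hsq, hp1, weightCount_eq_countWt] at h
  generalize 3 ^ ((m - 1) / 2) = s at *
  have low := h (s ^ 2 - s)
  have mid := h (s ^ 2)
  have high := h (s ^ 2 + s)
  rw [if_neg (by omega), if_pos rfl] at low
  rw [if_neg (by omega), if_neg (by omega), if_pos rfl] at mid
  rw [if_neg (by omega), if_neg (by omega), if_neg (by omega), if_pos rfl] at high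
  have hC : IsThreeWeight s C := by
    intro u hu hu0
    by_contra! hne
    have h1 := h (hammingNorm u)
    rw [if_neg (hammingNorm_ne_zero_iff.2 hu0), if_neg hne.1, if_neg hne.2.1,
      if_neg hne.2.2, Nat.cast_eq_zero, countWt, Finset.card_eq_zero,
      Finset.filter_eq_empty_iff] at h1
    exact h1 (mem_words.2 hu) rfl
  refine ⟨hs, hlen, hC, ?_, low, mid, high⟩
  -- Summing the constant 1 over all words recovers the size of the code from the frequencies.
  have h1 := sum_weight_eq (s := s) (by omega) (S := words C) (by simp)
    (fun u hu => hC u (mem_words.1 hu)) fun _ => 1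
  rw [low, mid, high, Finset.sum_const, nsmul_eq_mul, card_words] at h1
  have : (Nat.card C : ℚ) = 9 * s ^ 4 := by linear_combination h1
  exact_mod_cast this

end TernaryDesigns

/-! ### Powers of the generator as projective points -/

namespace TernaryDesigns

theorem charP_three (F : Type*) [Field F] [Algebra (ZMod 3) F] : CharP F 3 :=
  (Algebra.charP_iff (ZMod 3) F 3).1 inferInstance

theorem two_ne_zero_of_algebra {F : Type*} [Field F] [Algebra (ZMod 3) F] : (2 : F) ≠ 0 := by
  have := charP_three F
  intro h2
  have h3 : (3 : F) = 0 := by exact_mod_cast CharP.cast_eq_zero F 3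
  exact one_ne_zero (α := F) (by linear_combination h3 - h2)

section Generator

variable {m : ℕ} {F : Type*} [Field F] [Fintype F] {α : Fˣ}

theorem orderOf_generator (hF : Fintype.card F = 3 ^ m)
    (hα : ∀ x : Fˣ, x ∈ Subgroup.zpowers α) : orderOf α = 2 * ((3 ^ m - 1) / 2) := by
  classical
  rw [orderOf_eq_card_of_forall_mem_zpowers hα, Nat.card_eq_fintype_card, Fintype.card_units, hF]
  have h : Odd (3 ^ m) := Odd.pow (by decide)
  obtain ⟨r, hr⟩ := h
  omega

theorem generator_pow_half (hm : 5 ≤ m) (hF : Fintype.card F = 3 ^ m)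
    (hα : ∀ x : Fˣ, x ∈ Subgroup.zpowers α) : (α : F) ^ ((3 ^ m - 1) / 2) = -1 := by
  have ho := orderOf_generator hF hα
  have hpos : 0 < (3 ^ m - 1) / 2 := by
    have : 3 ^ 5 ≤ 3 ^ m := Nat.pow_le_pow_right (by norm_num) hm
    omega
  have h1 : ((α : F) ^ ((3 ^ m - 1) / 2)) ^ 2 = 1 := by
    rw [← pow_mul, mul_comm, ← ho, ← Units.val_pow_eq_pow_val, pow_orderOf_eq_one, Units.val_one]
  rcases eq_or_eq_neg_of_sq_eq_sq _ _ (h1.trans (one_pow 2).symm) with h | h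
  · exfalso
    have h2 : α ^ ((3 ^ m - 1) / 2) = 1 := by
      ext
      simpa using h
    have := orderOf_le_of_pow_eq_one hpos h2
    omega
  · exact h

/-- Exponents run up to `2n`, and `α ^ n = -1` folds the upper half onto the lower half with a sign.
-/
theorem exists_generator_pow (hm : 5 ≤ m) (hF : Fintype.card F = 3 ^ m)
    (hα : ∀ x : Fˣ, x ∈ Subgroup.zpowers α) {x : F} (hx : x ≠ 0) :
    ∃ i : Fin ((3 ^ m - 1) / 2), x = (α : F) ^ (i : ℕ) ∨ x = -(α : F) ^ (i : ℕ) := by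
  classical
  have ho := orderOf_generator hF hα
  have hh := generator_pow_half hm hF hα
  have hmem : Units.mk0 x hx ∈ Subgroup.zpowers α := hα _
  rw [mem_zpowers_iff_mem_range_orderOf, Finset.mem_image] at hmem
  obtain ⟨k, hk, hkx⟩ := hmem
  rw [Finset.mem_range, ho] at hk
  have hkx' : (α : F) ^ k = x := by
    have := congrArg Units.val hkx
    simpa using this
  by_cases hlt : k < (3 ^ m - 1) / 2
  · exact ⟨⟨k, hlt⟩, Or.inl hkx'.symm⟩
  · refine ⟨⟨k - (3 ^ m - 1) / 2, by omega⟩, Or.inr ?_⟩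
    have hsplit : k = (3 ^ m - 1) / 2 + (k - (3 ^ m - 1) / 2) := by omega
    rw [← hkx']
    conv_lhs => rw [hsplit, pow_add, hh]
    simp

theorem generator_pow_injective (hm : 5 ≤ m) (hF : Fintype.card F = 3 ^ m)
    (hα : ∀ x : Fˣ, x ∈ Subgroup.zpowers α) {i j : Fin ((3 ^ m - 1) / 2)}
    (h : (α : F) ^ (i : ℕ) = (α : F) ^ (j : ℕ) ∨ (α : F) ^ (i : ℕ) = -(α : F) ^ (j : ℕ)) :
    i = j := by
  have ho := orderOf_generator hF hα
  have hh := generator_pow_half hm hF hα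
  have key : ∀ a b : ℕ, a < orderOf α → b < orderOf α → (α : F) ^ a = (α : F) ^ b → a = b := by
    intro a b ha hb hab
    refine pow_injOn_Iio_orderOf (Set.mem_Iio.2 ha) (Set.mem_Iio.2 hb) ?_
    ext
    simpa using hab
  have hi := i.2
  have hj := j.2
  rcases h with h | h
  · exact Fin.ext (key _ _ (by omega) (by omega) h)
  · rw [neg_eq_neg_one_mul, ← hh, ← pow_add] at h
    have := key _ _ (by omega) (by omega) h
    omega

variable [Algebra (ZMod 3) F]

theorem card_filter_eq_two_mul (hm : 5 ≤ m) (hF : Fintype.card F = 3 ^ m)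
    (hα : ∀ x : Fˣ, x ∈ Subgroup.zpowers α) (p : F → Prop) [DecidablePred p]
    (hp : ∀ x, p (-x) ↔ p x) (h0 : ¬ p 0) :
    (Finset.univ.filter p).card = 2 * (Finset.univ.filter
      fun i : Fin ((3 ^ m - 1) / 2) => p ((α : F) ^ (i : ℕ))).card := by
  classical
  have h1 : Finset.univ.filter p =
      (Finset.univ.filter fun i : Fin ((3 ^ m - 1) / 2) => p ((α : F) ^ (i : ℕ))).image
        (fun i : Fin ((3 ^ m - 1) / 2) => (α : F) ^ (i : ℕ)) ∪
      (Finset.univ.filter fun i : Fin ((3 ^ m - 1) / 2) => p ((α : F) ^ (i : ℕ))).image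
        (fun i : Fin ((3 ^ m - 1) / 2) => -(α : F) ^ (i : ℕ)) := by
    ext x
    simp only [Finset.mem_filter, Finset.mem_univ, true_and, Finset.mem_union, Finset.mem_image]
    constructor
    · intro hx
      obtain ⟨i, rfl | rfl⟩ := exists_generator_pow hm hF hα (x := x) (by rintro rfl; exact h0 hx)
      · exact Or.inl ⟨i, hx, rfl⟩
      · exact Or.inr ⟨i, (hp _).1 hx, rfl⟩
    · rintro (⟨i, hi, rfl⟩ | ⟨i, hi, rfl⟩)
      · exact hi
      · exact (hp _).2 hi
  have hz : ∀ i : ℕ, (α : F) ^ i ≠ 0 := fun i => pow_ne_zero _ α.ne_zero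
  have h2 := two_ne_zero_of_algebra (F := F)
  rw [h1, Finset.card_union_of_disjoint, Finset.card_image_of_injective,
    Finset.card_image_of_injective, two_mul]
  · exact fun i j h => generator_pow_injective hm hF hα (Or.inl (neg_injective h))
  · exact fun i j h => generator_pow_injective hm hF hα (Or.inl h)
  · rw [Finset.disjoint_left]
    intro x hx hx'
    simp only [Finset.mem_filter, Finset.mem_univ, true_and, Finset.mem_image] at hx hx'
    obtain ⟨i, -, rfl⟩ := hx
    obtain ⟨j, -, hj⟩ := hx'
    obtain rfl := generator_pow_injective hm hF hα (Or.inr hj.symm)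
    apply hz i
    have : (2 : F) * (α : F) ^ (i : ℕ) = 0 := by linear_combination -hj
    exact (mul_eq_zero.1 this).resolve_left h2

end Generator

end TernaryDesigns

/-! ### Quadratic forms and lines -/

namespace TernaryDesigns

section QuadraticForm

variable {F : Type*} [Field F] [Algebra (ZMod 3) F] {ι : Type*} [Fintype ι]

/-- The quadratic form `x ↦ Tr (∑ j, a j * x ^ (3 ^ f j + 1))`. -/
noncomputable def quadVal (f : ι → ℕ) (a : ι → F) (x : F) : ZMod 3 :=
  Algebra.trace (ZMod 3) F (∑ j, a j * x ^ (3 ^ f j + 1))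

theorem quadVal_neg (f : ι → ℕ) (a : ι → F) (x : F) : quadVal f a (-x) = quadVal f a x := by
  have : ∀ j, Even (3 ^ f j + 1) := fun j => (Odd.pow (by decide)).add_one
  simp only [quadVal, (this _).neg_pow]

theorem quadVal_zero (f : ι → ℕ) (a : ι → F) : quadVal f a 0 = 0 := by
  simp [quadVal]

/-- The polar form of `quadVal`. -/
noncomputable def polarForm (f : ι → ℕ) (a : ι → F) : F →+ F →+ ZMod 3 :=
  AddMonoidHom.mk' (fun x => AddMonoidHom.mk'
    (fun y => Algebra.trace (ZMod 3) F (∑ j, a j * (x ^ 3 ^ f j * y + x * y ^ 3 ^ f j)))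
    (by
      have := charP_three F
      intro y z
      rw [← map_add, ← Finset.sum_add_distrib]
      congr 1
      refine Finset.sum_congr rfl fun j _ => ?_
      rw [add_pow_char_pow]
      ring))
    (by
      have := charP_three F
      intro x z
      ext y
      simp only [AddMonoidHom.mk'_apply, AddMonoidHom.add_apply]
      rw [← map_add, ← Finset.sum_add_distrib]
      congr 1
      refine Finset.sum_congr rfl fun j _ => ?_
      rw [add_pow_char_pow]
      ring)

theorem polarForm_apply (f : ι → ℕ) (a : ι → F) (x y : F) : polarForm f a x y =
    Algebra.trace (ZMod 3) F (∑ j, a j * (x ^ 3 ^ f j * y + x * y ^ 3 ^ f j)) := rfl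

theorem quadVal_add (f : ι → ℕ) (a : ι → F) (x y : F) :
    quadVal f a (x + y) = quadVal f a x + quadVal f a y + polarForm f a x y := by
  have := charP_three F
  simp only [quadVal, polarForm_apply]
  rw [← map_add, ← map_add, ← Finset.sum_add_distrib, ← Finset.sum_add_distrib]
  congr 1
  refine Finset.sum_congr rfl fun j _ => ?_
  rw [pow_succ, add_pow_char_pow]
  ring

/-- By the parallelogram law the sum is `3 q x + 3 q y`. The four arguments represent the points of
the projective line through `x` and `y`. -/
theorem quadVal_line (f : ι → ℕ) (a : ι → F) (x y : F) :
    quadVal f a x + quadVal f a y + quadVal f a (x + y) + quadVal f a (x - y) = 0 := by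
  have h : (3 : ZMod 3) = 0 := by decide
  rw [sub_eq_add_neg, quadVal_add, quadVal_add, quadVal_neg, map_neg]
  linear_combination (quadVal f a x + quadVal f a y) * h

end QuadraticForm

section Lines

variable {F : Type*} [Field F] [Algebra (ZMod 3) F] {α : Fˣ}
  {ι : Type*} [Fintype ι]

theorem mem_traceCode_iff {n : ℕ} {f : ι → ℕ} {c : Fin n → ZMod 3} :
    c ∈ traceCode (α : F) n (fun j => 3 ^ f j + 1) ↔
      ∃ a : ι → F, ∀ i : Fin n, c i = quadVal f a ((α : F) ^ (i : ℕ)) := by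
  simp only [traceCode, quadVal, Submodule.mem_mk, AddSubmonoid.mem_mk, ← pow_mul']
  rfl

theorem quadVal_of_eq_or_eq_neg {f : ι → ℕ} {a : ι → F} {x y : F} (h : x = y ∨ x = -y) :
    quadVal f a x = quadVal f a y := by
  rcases h with rfl | rfl
  · rfl
  · exact quadVal_neg f a y

theorem two_le_card_wordsOn_four [Fintype F] {m : ℕ} (hm : 5 ≤ m) (hF : Fintype.card F = 3 ^ m)
    (hα : ∀ x : Fˣ, x ∈ Subgroup.zpowers α) {f : ι → ℕ}
    {C : Submodule (ZMod 3) (Fin ((3 ^ m - 1) / 2) → ZMod 3)}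
    (hC : C ≤ traceCode (α : F) ((3 ^ m - 1) / 2) (fun j => 3 ^ f j + 1))
    {T : Finset (Fin ((3 ^ m - 1) / 2))} (hT : T.card = 2) :
    2 ≤ (wordsOn (dualCode C) T 4).card := by
  obtain ⟨i, j, hij, rfl⟩ := Finset.card_eq_two.1 hT
  have hinj := fun {i j : Fin ((3 ^ m - 1) / 2)} =>
    generator_pow_injective hm hF hα (i := i) (j := j)
  have hx : (α : F) ^ (i : ℕ) ≠ 0 := pow_ne_zero _ α.ne_zero
  have hy : (α : F) ^ (j : ℕ) ≠ 0 := pow_ne_zero _ α.ne_zero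
  have h1 : (α : F) ^ (i : ℕ) + (α : F) ^ (j : ℕ) ≠ 0 :=
    fun h => hij (hinj (Or.inr (eq_neg_of_add_eq_zero_left h)))
  have h2 : (α : F) ^ (i : ℕ) - (α : F) ^ (j : ℕ) ≠ 0 :=
    fun h => hij (hinj (Or.inl (sub_eq_zero.1 h)))
  obtain ⟨k, hk⟩ := exists_generator_pow hm hF hα h1
  obtain ⟨l, hl⟩ := exists_generator_pow hm hF hα h2
  have h3 : (3 : F) = 0 := by
    have := charP_three F
    exact_mod_cast CharP.cast_eq_zero F 3
  have h20 := two_ne_zero_of_algebra (F := F)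
  have hik : i ≠ k := by
    rintro rfl
    rcases hk with hk | hk
    · exact hy (by linear_combination hk)
    · exact hij (hinj (Or.inl (by linear_combination -hk + (α : F) ^ (i : ℕ) * h3)))
  have hjk : j ≠ k := by
    rintro rfl
    rcases hk with hk | hk
    · exact hx (by linear_combination hk)
    · exact hij (hinj (Or.inl (by linear_combination hk - (α : F) ^ (j : ℕ) * h3)))
  have hil : i ≠ l := by
    rintro rfl
    rcases hl with hl | hl
    · exact hy (by linear_combination -hl)
    · exact hij (hinj (Or.inr (by linear_combination -hl + (α : F) ^ (i : ℕ) * h3)))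
  have hjl : j ≠ l := by
    rintro rfl
    rcases hl with hl | hl
    · exact hij (hinj (Or.inr (by linear_combination hl + (α : F) ^ (j : ℕ) * h3)))
    · exact hx (by linear_combination hl)
  have hkl : k ≠ l := by
    rintro rfl
    -- Equality up to sign gives equal squares of `x + y` and `x - y`, hence `4xy = 0`, that is `xy
    -- = 0` in characteristic 3.
    have h4 : ((α : F) ^ (i : ℕ) + (α : F) ^ (j : ℕ)) ^ 2 =
        ((α : F) ^ (i : ℕ) - (α : F) ^ (j : ℕ)) ^ 2 := by
      rcases hk with hk | hk <;> rcases hl with hl | hl <;> rw [hk, hl] <;> ring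
    have h5 : (α : F) ^ (i : ℕ) * (α : F) ^ (j : ℕ) = 0 := by
      linear_combination h4 - (α : F) ^ (i : ℕ) * (α : F) ^ (j : ℕ) * h3
    exact mul_ne_zero hx hy h5
  let L : Finset (Fin ((3 ^ m - 1) / 2)) := {i, j, k, l}
  have hL : L.card = 4 := by
    simp [L, hij, hik, hil, hjk, hjl, hkl]
  let c : Fin ((3 ^ m - 1) / 2) → ZMod 3 := fun t => if t ∈ L then 1 else 0
  have hc : c ∈ dualCode C := by
    intro u hu
    obtain ⟨a, ha⟩ := mem_traceCode_iff.1 (hC hu)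
    simp only [c, ite_mul, one_mul, zero_mul]
    rw [← Finset.sum_filter, Finset.filter_mem_eq_inter, Finset.univ_inter]
    simp only [L]
    rw [Finset.sum_insert (by simp [hij, hik, hil]), Finset.sum_insert (by simp [hjk, hjl]),
      Finset.sum_pair hkl]
    simp only [ha]
    rw [← quadVal_of_eq_or_eq_neg hk, ← quadVal_of_eq_or_eq_neg hl]
    linear_combination quadVal_line f a ((α : F) ^ (i : ℕ)) ((α : F) ^ (j : ℕ))
  have hsupp : ∀ r : ZMod 3, r ≠ 0 → hammingNorm (r • c) = 4 := by
    intro r hr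
    rw [← hL, hammingNorm]
    congr 1
    ext t
    simp [c, hr]
  have hmem : ∀ r : ZMod 3, r ≠ 0 → r • c ∈ wordsOn (dualCode C) {i, j} 4 := by
    intro r hr
    simp only [wordsOn, Finset.mem_filter, mem_words]
    refine ⟨Submodule.smul_mem _ r hc, ?_, hsupp r hr⟩
    intro t ht
    have : t ∈ L := by
      simp only [Finset.mem_insert, Finset.mem_singleton] at ht
      rcases ht with rfl | rfl <;> simp [L]
    simp [c, this, hr]
  have hne : (1 : ZMod 3) • c ≠ (2 : ZMod 3) • c := by
    intro h
    have := congrFun h i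
    simp [c, L] at this
    exact absurd this (by decide)
  calc 2 = ({(1 : ZMod 3) • c, (2 : ZMod 3) • c} : Finset _).card := (Finset.card_pair hne).symm
    _ ≤ _ := by
      refine Finset.card_le_card ?_
      intro d hd
      rcases Finset.mem_insert.1 hd with rfl | hd
      · exact hmem 1 (by decide)
      · rw [Finset.mem_singleton.1 hd]
        exact hmem 2 (by decide)

end Lines

end TernaryDesigns

/-! ### Weights from the order of the radical -/

namespace TernaryDesigns

/-- Descent: 3 divides `u`, and writing `u = 3w` gives `v ^ 2 + 3 w ^ 2 = 3 ^ (k - 1)`, with the two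
roles exchanged. -/
theorem sq_add_three_mul_sq_eq {k : ℕ} : ∀ {u v : ℤ}, u ^ 2 + 3 * v ^ 2 = 3 ^ k →
    (Even k → u ^ 2 = 3 ^ k) ∧ (Odd k → u = 0) := by
  induction k with
  | zero =>
    intro u v h
    refine ⟨fun _ => ?_, fun h => by simp at h⟩
    have hv : v = 0 := by
      by_contra hv
      have : 1 ≤ v ^ 2 := by
        have := sq_pos_of_ne_zero hv
        omega
      nlinarith [sq_nonneg u]
    subst hv
    simpa using h
  | succ k ih =>
    intro u v h
    have h3 : (3 : ℤ) ∣ u := by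
      refine Int.prime_three.dvd_of_dvd_pow (n := 2) ⟨3 ^ k - v ^ 2, ?_⟩
      rw [pow_succ (3 : ℤ) k] at h
      linarith
    obtain ⟨w, rfl⟩ := h3
    have h1 : v ^ 2 + 3 * w ^ 2 = 3 ^ k := by
      rw [pow_succ (3 : ℤ) k] at h
      linarith
    obtain ⟨he, ho⟩ := ih h1
    constructor
    · intro hk
      have hv := ho (by rwa [Nat.even_add_one, Nat.not_even_iff_odd] at hk)
      subst hv
      rw [pow_succ (3 : ℤ) k, ← h1]
      ring
    · intro hk
      have hv := he (by rwa [Nat.odd_add_one, Nat.not_odd_iff_even] at hk)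
      have hw : w ^ 2 = 0 := by linarith
      rw [pow_eq_zero_iff two_ne_zero] at hw
      rw [hw, mul_zero]

/-- The real character sum weight on `GF(3)`: `2` at zero and `-1` elsewhere. -/
def realChar (t : ZMod 3) : ℤ := if t = 0 then 2 else -1

theorem sum_realChar_hom {G : Type*} [AddGroup G] [Fintype G] (ℓ : G →+ ZMod 3) (c : ZMod 3)
    (hℓ : ℓ ≠ 0) : ∑ x, realChar (c + ℓ x) = 0 := by
  obtain ⟨x₀, hx₀⟩ : ∃ x, ℓ x ≠ 0 := by
    by_contra! h
    exact hℓ (AddMonoidHom.ext h)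
  have h1 : ∑ x, realChar (c + ℓ x) = ∑ x, realChar (c + ℓ x + ℓ x₀) := by
    rw [← Equiv.sum_comp (Equiv.addRight x₀)]
    simp [add_assoc]
  have h2 : ∑ x, realChar (c + ℓ x) = ∑ x, realChar (c + ℓ x + (ℓ x₀ + ℓ x₀)) := by
    rw [← Equiv.sum_comp (Equiv.addRight (x₀ + x₀))]
    simp [add_assoc]
  have h3 : ∑ x, realChar (c + ℓ x) + ∑ x, realChar (c + ℓ x + ℓ x₀) +
      ∑ x, realChar (c + ℓ x + (ℓ x₀ + ℓ x₀)) = 0 := by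
    rw [← Finset.sum_add_distrib, ← Finset.sum_add_distrib]
    refine Finset.sum_eq_zero fun x _ => ?_
    have key : ∀ a b : ZMod 3, b ≠ 0 →
        realChar a + realChar (a + b) + realChar (a + (b + b)) = 0 := by
      decide
    exact key _ _ hx₀
  linarith

/-- This is `|S|² = |G| |rad|` for `S = ∑ ω ^ q x`, doubled because `realChar t = ω ^ t + ω ^ (-t)`.
Replacing `x` by `x + y` makes the phase affine in `y`; the sum over `y` vanishes unless `x` lies in
the radical. -/
theorem sum_sum_realChar {G : Type*} [AddCommGroup G] [Fintype G] (q : G → ZMod 3)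
    (B : G →+ G →+ ZMod 3) (hq : ∀ x y, q (x + y) = q x + q y + B x y)
    (hneg : ∀ x, q (-x) = q x) :
    ∑ x, ∑ y, realChar (q x - q y) = 2 * Fintype.card G * Nat.card B.ker := by
  classical
  -- On the radical, expanding `q (x + (-x))` gives `2 q x = q 0`, while `q 0 = 2 q 0` forces `q 0 =
  -- 0`.
  have h0 : ∀ x, B x = 0 → q x = 0 := by
    intro x hx
    have h1 := hq x (-x)
    have h2 := hq 0 0
    rw [hx, hneg] at h1
    simp only [add_neg_cancel, AddMonoidHom.zero_apply, map_zero, add_zero] at h1 h2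
    revert h1 h2
    generalize q 0 = a
    generalize q x = b
    revert a b
    decide
  have h1 : ∑ x, ∑ y, realChar (q x - q y) = ∑ x, ∑ y, realChar (q x + B x y) := by
    rw [Finset.sum_comm]
    have : ∀ y, ∑ x, realChar (q x - q y) = ∑ x, realChar (q x + B x y) := by
      intro y
      rw [← Equiv.sum_comp (Equiv.addRight y)]
      refine Finset.sum_congr rfl fun x _ => ?_
      rw [Equiv.coe_addRight, hq]
      congr 1
      ring
    simp_rw [this]
    rw [Finset.sum_comm]
  have h2 : ∀ x, ∑ y, realChar (q x + B x y) =
      if x ∈ B.ker then 2 * (Fintype.card G : ℤ) else 0 := by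
    intro x
    split_ifs with hx
    · rw [AddMonoidHom.mem_ker] at hx
      simp [h0 x hx, hx, realChar, mul_comm]
    · exact sum_realChar_hom _ _ hx
  rw [h1]
  simp_rw [h2]
  rw [← Finset.sum_filter, Finset.sum_const, nsmul_eq_mul, mul_comm, ← Fintype.card_subtype,
    Nat.card_eq_fintype_card]

theorem sum_sum_realChar_eq {G : Type*} [Fintype G] (q : G → ZMod 3) (N : ZMod 3 → ℤ)
    (hN : ∀ c, N c = (Finset.univ.filter fun x => q x = c).card) :
    ∑ x, ∑ y, realChar (q x - q y) =
      2 * (N 0 ^ 2 + N 1 ^ 2 + N 2 ^ 2 - N 0 * N 1 - N 0 * N 2 - N 1 * N 2) := by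
  have h1 : ∀ g : ZMod 3 → ℤ, ∑ x, g (q x) = N 0 * g 0 + N 1 * g 1 + N 2 * g 2 := by
    intro g
    have hs : ∀ f : ZMod 3 → ℤ, ∑ v, f v = f 0 + f 1 + f 2 := fun f => Fin.sum_univ_three f
    rw [← Finset.sum_fiberwise (g := q), ← hs fun c => N c * g c]
    refine Finset.sum_congr rfl fun c _ => ?_
    rw [Finset.sum_congr rfl (g := fun _ => g c), Finset.sum_const, nsmul_eq_mul, hN]
    intro x hx
    rw [(Finset.mem_filter.1 hx).2]
  have h2 : ∀ x, ∑ y, realChar (q x - q y) = N 0 * realChar (q x) + N 1 * realChar (q x - 1) +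
      N 2 * realChar (q x - 2) := by
    intro x
    rw [h1 fun c => realChar (q x - c), sub_zero]
  simp_rw [h2]
  rw [h1 fun c => N 0 * realChar c + N 1 * realChar (c - 1) + N 2 * realChar (c - 2)]
  have e0 : realChar 0 = 2 := rfl
  have e1 : realChar 1 = -1 := rfl
  have e2 : realChar 2 = -1 := rfl
  have e3 : realChar (0 - 1) = -1 := rfl
  have e4 : realChar (0 - 2) = -1 := rfl
  have e5 : realChar (1 - 1) = 2 := rfl
  have e6 : realChar (1 - 2) = -1 := rfl
  have e7 : realChar (2 - 1) = -1 := rfl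
  have e8 : realChar (2 - 2) = 2 := rfl
  rw [e0, e1, e2, e3, e4, e5, e6, e7, e8]
  ring

section Weight

variable {m : ℕ} {F : Type*} [Field F] [Fintype F] [Algebra (ZMod 3) F] {α : Fˣ}
  {ι : Type*} [Fintype ι]

/-- Let `z` count the zeros of the form in the field, and `x`, `y` the coordinates of `u` equal to 1
and 2. The exponential sum is `z + 2xω + 2yω² = (z - x - y) + (x - y)√-3`, and `z + 2x + 2y = 3 ^ m`
makes its real part `3 ^ m - 3 (x + y)`. -/
theorem norm_equation (hm : 5 ≤ m) (hF : Fintype.card F = 3 ^ m)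
    (hα : ∀ x : Fˣ, x ∈ Subgroup.zpowers α) (f : ι → ℕ) (a : ι → F)
    {u : Fin ((3 ^ m - 1) / 2) → ZMod 3} (hu : ∀ i, u i = quadVal f a ((α : F) ^ (i : ℕ))) :
    ∃ v : ℤ, (3 ^ m - 3 * (hammingNorm u : ℤ)) ^ 2 + 3 * v ^ 2 =
      3 ^ m * Nat.card (polarForm f a).ker := by
  classical
  have h1 := sum_sum_realChar (quadVal f a) (polarForm f a) (quadVal_add f a) (quadVal_neg f a)
  rw [sum_sum_realChar_eq _ (fun c => (Finset.univ.filter fun x => quadVal f a x = c).card)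
    fun _ => rfl] at h1
  have h2 : ∀ c : ZMod 3, c ≠ 0 → (Finset.univ.filter fun x => quadVal f a x = c).card =
      2 * (Finset.univ.filter fun i => u i = c).card := by
    intro c hc
    rw [card_filter_eq_two_mul hm hF hα (fun x => quadVal f a x = c)
      (fun x => by rw [quadVal_neg]) (by rw [quadVal_zero]; exact hc.symm)]
    simp only [hu]
  have h3 : hammingNorm u = (Finset.univ.filter fun i => u i = 1).card +
      (Finset.univ.filter fun i => u i = 2).card := by
    rw [hammingNorm, ← Finset.card_union_of_disjoint, ← Finset.filter_or]
    · congr 1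
      ext i
      simp only [Finset.mem_filter, Finset.mem_univ, true_and]
      generalize u i = t
      revert t
      decide
    · rw [Finset.disjoint_left]
      intro i hi hi'
      rw [Finset.mem_filter] at hi hi'
      exact absurd (hi.2.symm.trans hi'.2) (by decide)
  have h4 : (Finset.univ.filter fun x => quadVal f a x = 0).card +
      (Finset.univ.filter fun x => quadVal f a x = 1).card +
      (Finset.univ.filter fun x => quadVal f a x = 2).card = 3 ^ m := by
    rw [← hF, ← Finset.card_univ, Finset.card_eq_sum_card_fiberwise (f := quadVal f a)
      (s := Finset.univ) (t := Finset.univ) (fun _ _ => Finset.mem_coe.2 (Finset.mem_univ _))]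
    exact (Fin.sum_univ_three fun c : ZMod 3 =>
      (Finset.univ.filter fun x => quadVal f a x = c).card).symm
  rw [h2 1 (by decide), h2 2 (by decide)] at h1 h4
  rw [hF] at h1
  refine ⟨(Finset.univ.filter fun i => u i = 1).card - (Finset.univ.filter fun i => u i = 2).card,
    ?_⟩
  rw [h3]
  generalize (Finset.univ.filter fun i => u i = 1).card = x at *
  generalize (Finset.univ.filter fun i => u i = 2).card = y at *
  generalize (Finset.univ.filter fun x => quadVal f a x = 0).card = z at *
  have h5 : (z : ℤ) + 2 * x + 2 * y = 3 ^ m := by exact_mod_cast h4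
  push_cast at h1 ⊢
  rw [← h5] at h1 ⊢
  linarith

/-- The radical has order `3 ^ d` with `d ≤ 2`, and `m` is odd. For `d = 1` the norm is an even
power of 3 and the weight is `s² ± s`; for `d = 0` or `2` the real part vanishes and the weight is
`s²`. -/
theorem weight_of_ker (hm : 5 ≤ m) (hodd : Odd m) (hF : Fintype.card F = 3 ^ m)
    (hα : ∀ x : Fˣ, x ∈ Subgroup.zpowers α) (f : ι → ℕ) (a : ι → F)
    {u : Fin ((3 ^ m - 1) / 2) → ZMod 3} (hu : ∀ i, u i = quadVal f a ((α : F) ^ (i : ℕ)))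
    (hker : Nat.card (polarForm f a).ker ≤ 9) :
    hammingNorm u = (3 ^ ((m - 1) / 2)) ^ 2 - 3 ^ ((m - 1) / 2) ∨
    hammingNorm u = (3 ^ ((m - 1) / 2)) ^ 2 ∨
    hammingNorm u = (3 ^ ((m - 1) / 2)) ^ 2 + 3 ^ ((m - 1) / 2) := by
  obtain ⟨v, hv⟩ := norm_equation hm hF hα f a hu
  have hdvd : Nat.card (polarForm f a).ker ∣ 3 ^ m := by
    rw [← hF, ← Nat.card_eq_fintype_card]
    exact AddSubgroup.card_addSubgroup_dvd_card _
  obtain ⟨d, -, hd⟩ := (Nat.dvd_prime_pow Nat.prime_three).1 hdvd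
  have hd2 : d ≤ 2 := by
    by_contra! h
    have : 3 ^ 3 ≤ 3 ^ d := Nat.pow_le_pow_right (by norm_num) h
    omega
  rw [hd] at hv
  push_cast at hv
  rw [← pow_add] at hv
  have h3 := three_pow_eq hodd
  have h3' : (3 : ℤ) ^ m = 3 * (3 ^ ((m - 1) / 2)) ^ 2 := by exact_mod_cast h3
  have hle : 3 ^ ((m - 1) / 2) ≤ (3 ^ ((m - 1) / 2)) ^ 2 := Nat.le_self_pow two_ne_zero _
  obtain ⟨he, ho⟩ := sq_add_three_mul_sq_eq hv
  by_cases hd1 : d = 1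
  · subst hd1
    have h4 := he hodd.add_one
    rw [pow_succ (3 : ℤ) m, h3'] at h4
    have h5 : (3 * (3 ^ ((m - 1) / 2)) ^ 2 - 3 * (hammingNorm u : ℤ)) ^ 2 =
        (3 * 3 ^ ((m - 1) / 2)) ^ 2 := by rw [h4]; ring
    rcases eq_or_eq_neg_of_sq_eq_sq _ _ h5 with h6 | h6
    · left
      zify [hle]
      linarith
    · right; right
      zify
      linarith
  · right; left
    have h4 := ho (by
      have : d = 0 ∨ d = 2 := by omega
      rcases this with rfl | rfl
      · exact hodd
      · exact hodd.add_even (by decide))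
    rw [h3'] at h4
    zify
    linarith

end Weight

end TernaryDesigns

/-! ### Trace duality and the non-square obstruction -/

namespace TernaryDesigns
open Polynomial

section Trace

variable {F : Type*} [Field F] [Fintype F] [Algebra (ZMod 3) F]

theorem trace_pow_three_pow (z : F) (k : ℕ) :
    Algebra.trace (ZMod 3) F (z ^ 3 ^ k) = Algebra.trace (ZMod 3) F z := by
  induction k with
  | zero => simp
  | succ k ih =>
    rw [← ih, pow_succ, pow_mul]
    have := Algebra.trace_eq_of_algEquiv (FiniteField.frobeniusAlgEquivOfAlgebraic (ZMod 3) F)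
      (z ^ 3 ^ k)
    simpa [FiniteField.coe_frobeniusAlgEquivOfAlgebraic, ZMod.card] using this

theorem eq_zero_of_trace_mul_eq_zero {z : F}
    (h : ∀ y, Algebra.trace (ZMod 3) F (y * z) = 0) : z = 0 := by
  have := (traceForm_nondegenerate (ZMod 3) F).2 z
  exact this fun y => h y

theorem eq_zero_of_trace_pow_mul_eq_zero {z : F} (k : ℕ)
    (h : ∀ y, Algebra.trace (ZMod 3) F (y ^ 3 ^ k * z) = 0) : z = 0 := by
  have := charP_three F
  refine eq_zero_of_trace_mul_eq_zero fun y => ?_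
  obtain ⟨w, hw⟩ := (bijective_iterateFrobenius F 3 k).2 y
  rw [← hw, iterateFrobenius_def]
  exact h w

end Trace

section NonSquare

variable {F : Type*} [Field F] [Fintype F]

theorem card_le_natDegree {A : AddSubgroup F} {P : F[X]} (hP : P ≠ 0)
    (h : ∀ x ∈ A, P.eval x = 0) : Nat.card A ≤ P.natDegree := by
  classical
  have h1 : Nat.card A = ((Finset.univ.filter fun x => x ∈ A)).card := by
    rw [← Fintype.card_subtype, Nat.card_eq_fintype_card]
  rw [h1]
  refine (Finset.card_le_card (t := P.roots.toFinset) ?_).trans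
    ((Multiset.toFinset_card_le _).trans P.card_roots')
  intro x hx
  rw [Multiset.mem_toFinset, mem_roots hP]
  exact h x (Finset.mem_filter.1 hx).2

theorem not_isSquare_neg_one {m : ℕ} (hodd : Odd m) (hF : Fintype.card F = 3 ^ m) :
    ¬ IsSquare (-1 : F) := by
  rw [FiniteField.isSquare_neg_one_iff, hF, not_not]
  obtain ⟨r, rfl⟩ := hodd
  rw [pow_succ, pow_mul, Nat.mul_mod, Nat.pow_mod]
  norm_num

theorem isSquare_neg_of_not_isSquare (hneg : ¬ IsSquare (-1 : F)) {x : F} (hx : ¬ IsSquare x) :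
    IsSquare (-x) := by
  classical
  have h1 : quadraticChar F x = -1 := quadraticChar_neg_one_iff_not_isSquare.2 hx
  have h2 : quadraticChar F (-1) = -1 := quadraticChar_neg_one_iff_not_isSquare.2 hneg
  have h3 : quadraticChar F (-x) = 1 := by
    rw [neg_eq_neg_one_mul, map_mul, h1, h2]
    norm_num
  have hx0 : -x ≠ 0 := by
    intro h0
    rw [h0] at h3
    simp at h3
  exact (quadraticChar_one_iff_isSquare hx0).1 h3

/-- In a symmetric set of nonzero elements, the product of all elements is a square up to the sign
determined by the number of pairs `{x, -x}`. -/
theorem prod_eq_neg_one_pow_mul_sq (hneg : ¬ IsSquare (-1 : F)) {S : Finset F}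
    (h0 : (0 : F) ∉ S) (hS : ∀ x ∈ S, -x ∈ S) {k : ℕ} (hk : S.card = 2 * k) :
    ∃ t : F, t ≠ 0 ∧ ∏ x ∈ S, x = (-1) ^ k * t ^ 2 := by
  classical
  have hns : ∀ x : F, x ≠ 0 → IsSquare x → ¬ IsSquare (-x) := by
    intro x hx h1 h2
    apply hneg
    have : (-1 : F) = -x * x⁻¹ := by field_simp
    rw [this]
    exact h2.mul h1.inv
  have h1 : S.filter (fun x => ¬ IsSquare x) = (S.filter fun x => IsSquare x).image (-·) := by
    ext x
    simp only [Finset.mem_filter, Finset.mem_image]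
    constructor
    · rintro ⟨hx, hsq⟩
      exact ⟨-x, ⟨hS x hx, isSquare_neg_of_not_isSquare hneg hsq⟩, neg_neg x⟩
    · rintro ⟨y, ⟨hy, hsq⟩, rfl⟩
      exact ⟨hS y hy, hns y (by rintro rfl; exact h0 hy) hsq⟩
  have hcard : (S.filter fun x => IsSquare x).card = k := by
    have := Finset.card_filter_add_card_filter_not (s := S) fun x => IsSquare x
    rw [h1, Finset.card_image_of_injective _ neg_injective] at this
    omega
  -- Exactly one of `x`, `-x` is a square, so the squares in `S` represent its `k` pairs; `t` is
  -- their product.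
  refine ⟨∏ x ∈ S.filter fun x => IsSquare x, x, ?_, ?_⟩
  · rw [Finset.prod_ne_zero_iff]
    rintro x hx rfl
    exact h0 (Finset.mem_filter.1 hx).1
  · rw [← Finset.prod_filter_mul_prod_filter_not S fun x => IsSquare x, h1,
      Finset.prod_image neg_injective.injOn, Finset.prod_neg, hcard]
    ring

/-- A linearized polynomial of degree `27` cannot have all its roots in a field in which `-1` is not
a square if the product of its extreme coefficients is a square. -/
theorem card_ne_of_linearized (hneg : ¬ IsSquare (-1 : F)) {A B C D : F} (hA : A ≠ 0)
    (hAD : IsSquare (A * D)) {V : AddSubgroup F}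
    (hV : ∀ x ∈ V, A * x ^ 27 + B * x ^ 9 + C * x ^ 3 + D * x = 0) : Nat.card V ≠ 27 := by
  classical
  intro hcard
  set S : Finset F := (Finset.univ.filter fun x => x ∈ V).erase 0 with hSdef
  have hScard : S.card = 26 := by
    rw [hSdef, Finset.card_erase_of_mem (by simp), ← Fintype.card_subtype,
      ← Nat.card_eq_fintype_card]
    have : Nat.card {x // x ∈ V} = 27 := hcard
    omega
  obtain ⟨t, ht0, ht⟩ := prod_eq_neg_one_pow_mul_sq hneg (S := S) (k := 13) (by simp [hSdef])
    (by
      intro x hx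
      simp only [hSdef, Finset.mem_erase, Finset.mem_filter, Finset.mem_univ, true_and, ne_eq,
        neg_eq_zero, neg_mem_iff] at hx ⊢
      exact hx) (by rw [hScard])
  -- The linearized polynomial divided by `X`: its 26 roots would be the nonzero elements of `V`, so
  -- its constant term would be `A` times their product.
  let Q : F[X] := Polynomial.C A * X ^ 26 + (Polynomial.C B * X ^ 8 + Polynomial.C C * X ^ 2 +
    Polynomial.C D)
  have hlow : (Polynomial.C B * X ^ 8 + Polynomial.C C * X ^ 2 +
      Polynomial.C D : F[X]).degree < 26 := by
    refine lt_of_le_of_lt (b := 8) ?_ (by norm_num)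
    compute_degree!
  have hlead : (Polynomial.C A * X ^ 26 : F[X]).degree = 26 := degree_C_mul_X_pow 26 hA
  have hQdeg : Q.degree = 26 := by
    rw [degree_add_eq_left_of_degree_lt (by rwa [hlead]), hlead]
  have hQlead : Q.leadingCoeff = A := by
    rw [leadingCoeff_add_of_degree_lt' (by rwa [hlead]), leadingCoeff_C_mul_X_pow]
  have hprod : (Polynomial.C A * ∏ x ∈ S, (X - Polynomial.C x)).degree = 26 := by
    rw [degree_mul, degree_C hA, degree_prod_of_monic _ _ fun x _ => monic_X_sub_C x]
    simp [hScard]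
  have hQ : Q = Polynomial.C A * ∏ x ∈ S, (X - Polynomial.C x) := by
    refine eq_of_degree_le_of_eval_finset_eq S ?_ ?_ ?_ ?_
    · rw [hQdeg, hScard]
      rfl
    · rw [hQdeg, hprod]
    · rw [hQlead, leadingCoeff_mul, leadingCoeff_C,
        (monic_prod_of_monic _ _ fun x _ => monic_X_sub_C x).leadingCoeff, mul_one]
    · intro x hx
      rw [eval_mul, eval_prod, Finset.prod_eq_zero hx (by simp), mul_zero]
      simp only [hSdef, Finset.mem_erase, Finset.mem_filter, Finset.mem_univ, true_and] at hx
      apply mul_left_cancel₀ hx.1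
      rw [mul_zero, ← hV x hx.2]
      simp only [Q, eval_add, eval_mul, eval_C, eval_pow, eval_X]
      ring
  have hD : D = A * ∏ x ∈ S, x := by
    have := congrArg (eval 0) hQ
    rw [eval_mul, eval_prod] at this
    simp only [eval_sub, eval_X, eval_C, zero_sub] at this
    rw [Finset.prod_neg, hScard, Even.neg_one_pow (by decide), one_mul] at this
    simpa [Q] using this
  rw [ht] at hD
  apply hneg
  obtain ⟨w, hw⟩ := hAD
  refine ⟨w / (A * t), ?_⟩
  field_simp
  rw [hD] at hw
  linear_combination hw

end NonSquare

end TernaryDesigns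

/-! ### The weight distributions of the two explicit codes -/

namespace TernaryDesigns

open Polynomial

section Distribution

variable {m : ℕ} {F : Type*} [Field F] [Fintype F] [Algebra (ZMod 3) F] {α : Fˣ}

/-- Words with the single coefficient `b` at `j` pair to `Tr (b * _)`; nondegeneracy of the trace
turns orthogonality to all of them into a power-sum equation in the field. -/
theorem sum_smul_pow_eq_zero {ι : Type*} [Fintype ι] {n : ℕ} {f : ι → ℕ} (j : ι)
    {c : Fin n → ZMod 3}
    (hc : c ∈ dualCode (traceCode (α : F) n fun j => 3 ^ f j + 1)) :
    ∑ i, c i • ((α : F) ^ (i : ℕ)) ^ (3 ^ f j + 1) = 0 := by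
  classical
  refine eq_zero_of_trace_mul_eq_zero fun b => ?_
  have h := hc (fun i => quadVal f (Pi.single j b) ((α : F) ^ (i : ℕ)))
    (mem_traceCode_iff.2 ⟨_, fun i => rfl⟩)
  rw [Finset.mul_sum, map_sum, ← h]
  refine Finset.sum_congr rfl fun i _ => ?_
  rw [mul_smul_comm, map_smul, smul_eq_mul, quadVal, Finset.sum_eq_single j]
  · simp
  · intro k _ hk
    simp [hk]
  · simp

/-- A dual word of weight 2 would give a ratio `z` of two coordinate points with `z ^ (3 ^ f j + 1)
= ±1`. The exponent is even and `-1` is not a square, so the value is 1, and `z = ±1` contradicts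
distinctness of the points. -/
theorem three_le_hammingNorm (hm : 5 ≤ m) (hodd : Odd m) (hF : Fintype.card F = 3 ^ m)
    (hα : ∀ x : Fˣ, x ∈ Subgroup.zpowers α) {ι : Type*} [Fintype ι] {f : ι → ℕ} {j : ι}
    (hroot : ∀ z : F, z ^ (3 ^ f j + 1) = 1 → z = 1 ∨ z = -1)
    {c : Fin ((3 ^ m - 1) / 2) → ZMod 3}
    (hc : c ∈ dualCode (traceCode (α : F) ((3 ^ m - 1) / 2) fun j => 3 ^ f j + 1))
    (hc0 : c ≠ 0) : 3 ≤ hammingNorm c := by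
  by_contra! hlt
  have hsum := sum_smul_pow_eq_zero j hc
  have hpos : 0 < hammingNorm c := hammingNorm_pos_iff.2 hc0
  have hz : ∀ i : ℕ, (α : F) ^ i ≠ 0 := fun i => pow_ne_zero _ α.ne_zero
  have hred : ∑ i ∈ Finset.univ.filter (fun i => c i ≠ 0),
      c i • ((α : F) ^ (i : ℕ)) ^ (3 ^ f j + 1) = 0 := by
    rw [← hsum, Finset.sum_filter]
    refine Finset.sum_congr rfl fun i _ => ?_
    by_cases h : c i = 0 <;> simp [h]
  have hval : ∀ t : ZMod 3, t ≠ 0 → t = 1 ∨ t = -1 := by decide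
  rw [hammingNorm] at hlt hpos
  obtain h1 | h2 : (Finset.univ.filter fun i => c i ≠ 0).card = 1 ∨
      (Finset.univ.filter fun i => c i ≠ 0).card = 2 := by omega
  · obtain ⟨i, hi⟩ := Finset.card_eq_one.1 h1
    rw [hi, Finset.sum_singleton, smul_eq_zero] at hred
    have hci : c i ≠ 0 := by
      have : i ∈ Finset.univ.filter fun i => c i ≠ 0 := by rw [hi]; simp
      simpa using this
    exact hred.elim hci (pow_ne_zero _ (hz _))
  · obtain ⟨i, k, hik, hs⟩ := Finset.card_eq_two.1 h2
    rw [hs, Finset.sum_pair hik] at hred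
    have hmem : ∀ l, l ∈ ({i, k} : Finset _) → c l ≠ 0 := by
      intro l hl
      rw [← hs] at hl
      simpa using hl
    have hci := hval _ (hmem i (by simp))
    have hck := hval _ (hmem k (by simp))
    have hpm : ((α : F) ^ (i : ℕ) / (α : F) ^ (k : ℕ)) ^ (3 ^ f j + 1) = 1 ∨
        ((α : F) ^ (i : ℕ) / (α : F) ^ (k : ℕ)) ^ (3 ^ f j + 1) = -1 := by
      have hk0 := pow_ne_zero (3 ^ f j + 1) (hz k)
      rw [div_pow, div_eq_iff hk0, div_eq_iff hk0]
      rcases hci with hci | hci <;> rcases hck with hck | hck <;>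
        simp only [hci, hck, one_smul, neg_smul] at hred
      · right; linear_combination hred
      · left; linear_combination hred
      · left; linear_combination -hred
      · right; linear_combination -hred
    have hone : ((α : F) ^ (i : ℕ) / (α : F) ^ (k : ℕ)) ^ (3 ^ f j + 1) = 1 := by
      refine hpm.resolve_right fun h => not_isSquare_neg_one hodd hF ?_
      rw [← h]
      have he : Even (3 ^ f j + 1) := (Odd.pow (by decide)).add_one
      exact he.isSquare_pow _
    refine hik (generator_pow_injective hm hF hα ?_)
    rcases hroot _ hone with h | h
    · left
      rwa [div_eq_one_iff_eq (hz _)] at h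
    · right
      rw [div_eq_iff (hz _)] at h
      rw [h]
      ring

theorem hasDistribution_of_card_ker_le (hm : 5 ≤ m) (hodd : Odd m)
    (hF : Fintype.card F = 3 ^ m) (hα : ∀ x : Fˣ, x ∈ Subgroup.zpowers α) {f : Fin 2 → ℕ}
    (hker : ∀ a : Fin 2 → F, a ≠ 0 → Nat.card (polarForm f a).ker ≤ 9)
    {j : Fin 2} (hroot : ∀ z : F, z ^ (3 ^ f j + 1) = 1 → z = 1 ∨ z = -1) :
    HasDistribution (3 ^ ((m - 1) / 2))
      (traceCode (α : F) ((3 ^ m - 1) / 2) fun j => 3 ^ f j + 1) := by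
  have hs := nine_le hm
  have hlen := two_mul_length hodd
  have hw : ∀ a : Fin 2 → F, a ≠ 0 → _ :=
    fun a ha => weight_of_ker hm hodd hF hα f a (fun i => rfl) (hker a ha)
  have hC : IsThreeWeight (3 ^ ((m - 1) / 2))
      (traceCode (α : F) ((3 ^ m - 1) / 2) fun j => 3 ^ f j + 1) := by
    intro u hu hu0
    obtain ⟨a, ha⟩ := mem_traceCode_iff.1 hu
    have ha0 : a ≠ 0 := by
      rintro rfl
      apply hu0
      ext i
      rw [ha]
      simp [quadVal]
    have hua : u = fun i : Fin ((3 ^ m - 1) / 2) => quadVal f a ((α : F) ^ (i : ℕ)) := funext ha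
    rw [hua]
    exact hw a ha0
  let E : (Fin 2 → F) → traceCode (α : F) ((3 ^ m - 1) / 2) fun j => 3 ^ f j + 1 :=
    fun a => ⟨fun i => quadVal f a ((α : F) ^ (i : ℕ)), mem_traceCode_iff.2 ⟨a, fun i => rfl⟩⟩
  -- Injectivity holds because a nonzero difference of coefficients yields a word of one of the
  -- three positive weights.
  have hE : Function.Bijective E := by
    constructor
    · intro a b hab
      by_contra hne
      have h1 := hw (a - b) (sub_ne_zero.2 hne)
      have h2 : (fun i : Fin ((3 ^ m - 1) / 2) => quadVal f (a - b) ((α : F) ^ (i : ℕ))) = 0 := by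
        ext i
        have h3 := congrFun (congrArg Subtype.val hab) i
        simp only [E, quadVal] at h3
        simp only [quadVal, Pi.sub_apply, sub_mul, Finset.sum_sub_distrib, map_sub, Pi.zero_apply,
          h3, sub_self]
      rw [h2, hammingNorm_zero] at h1
      have h4 : 9 * 3 ^ ((m - 1) / 2) ≤ (3 ^ ((m - 1) / 2)) ^ 2 := by nlinarith
      omega
    · rintro ⟨u, hu⟩
      obtain ⟨a, ha⟩ := mem_traceCode_iff.1 hu
      exact ⟨a, Subtype.ext (funext fun i => (ha i).symm)⟩
  have hcard : Nat.card (traceCode (α : F) ((3 ^ m - 1) / 2) fun j => 3 ^ f j + 1) =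
      9 * (3 ^ ((m - 1) / 2)) ^ 4 := by
    rw [← Nat.card_congr (Equiv.ofBijective E hE), Nat.card_eq_fintype_card, Fintype.card_fun,
      hF, Fintype.card_fin, three_pow_eq hodd]
    ring
  obtain ⟨h1, h2, h3⟩ := countWt_of_dual (by omega) hlen hC hcard
    fun c hc hc0 => three_le_hammingNorm hm hodd hF hα hroot hc hc0
  exact ⟨hs, hlen, hC, hcard, h1, h2, h3⟩

end Distribution

section Radicals

theorem polarForm_two {F : Type*} [Field F] [Algebra (ZMod 3) F] (f : Fin 2 → ℕ)
    (a : Fin 2 → F) (x y : F) : polarForm f a x y =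
    Algebra.trace (ZMod 3) F (a 0 * x ^ 3 ^ f 0 * y) +
    Algebra.trace (ZMod 3) F (a 0 * x * y ^ 3 ^ f 0) +
    Algebra.trace (ZMod 3) F (a 1 * x ^ 3 ^ f 1 * y) +
    Algebra.trace (ZMod 3) F (a 1 * x * y ^ 3 ^ f 1) := by
  rw [polarForm_apply, Fin.sum_univ_two, ← map_add, ← map_add, ← map_add]
  congr 1
  ring

variable {F : Type*} [Field F]

theorem apply_one_ne_zero {a : Fin 2 → F} (ha : a ≠ 0) (h : a 0 = 0) : a 1 ≠ 0 := by
  intro h1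
  apply ha
  ext i
  fin_cases i
  · exact h
  · exact h1

variable [Fintype F]

/-- With `r = (m - 1) / 2`, the hypothesis says that `3 ^ r`-th powering inverts `z`. Applying it
twice and cubing gives `z = z ^ 3 ^ m = z ^ 3`. -/
theorem eq_one_or_neg_one_of_pow {m : ℕ} (hodd : Odd m) (hF : Fintype.card F = 3 ^ m) {z : F}
    (hz : z ^ (3 ^ ((m - 1) / 2) + 1) = 1) : z = 1 ∨ z = -1 := by
  have hz0 : z ≠ 0 := by
    rintro rfl
    simp at hz
  have h1 : z ^ 3 ^ m = z := by
    rw [← hF]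
    exact FiniteField.pow_card z
  have h2 : z ^ 3 ^ ((m - 1) / 2) = z⁻¹ := by
    rw [pow_succ] at hz
    exact eq_inv_of_mul_eq_one_left hz
  have h3 : z ^ 3 = z := by
    conv_rhs => rw [← h1, ← two_mul_half hodd, pow_succ, two_mul, pow_add, pow_mul, pow_mul, h2,
      inv_pow, h2, inv_inv]
  refine eq_or_eq_neg_of_sq_eq_sq _ _ (mul_left_cancel₀ hz0 ?_)
  linear_combination h3

variable [Algebra (ZMod 3) F]

/-- Frobenius invariance of the trace brings every term to the form `Tr (y ^ 3 * _)`, so the radical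
consists of roots of a nonzero polynomial of degree at most 9. -/
theorem card_ker_polarForm_one {a : Fin 2 → F} (ha : a ≠ 0) :
    Nat.card (polarForm ![1, 0] a).ker ≤ 9 := by
  have h2 := two_ne_zero_of_algebra (F := F)
  have hL : ∀ x ∈ (polarForm ![1, 0] a).ker,
      a 0 ^ 3 * x ^ 9 + 2 * a 1 ^ 3 * x ^ 3 + a 0 * x = 0 := by
    intro x hx
    refine eq_zero_of_trace_pow_mul_eq_zero 1 fun y => ?_
    have hxy : polarForm ![1, 0] a x y = 0 := by
      rw [AddMonoidHom.mem_ker.1 hx]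
      rfl
    rw [polarForm_two] at hxy
    simp only [Matrix.cons_val_zero, Matrix.cons_val_one, pow_zero, pow_one] at hxy
    rw [← trace_pow_three_pow (a 0 * x ^ 3 * y) 1, ← trace_pow_three_pow (a 1 * x * y) 1,
      ← map_add, ← map_add, ← map_add] at hxy
    rw [← hxy]
    congr 1
    ring
  have hP : (Polynomial.C (a 0 ^ 3) * X ^ 9 + Polynomial.C (2 * a 1 ^ 3) * X ^ 3 +
      Polynomial.C (a 0) * X : F[X]) ≠ 0 := by
    intro h0
    have h9 := congrArg (fun P => coeff P 9) h0
    have h3 := congrArg (fun P => coeff P 3) h0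
    simp only [coeff_add, coeff_C_mul, coeff_X_pow, coeff_X, coeff_zero] at h9 h3
    norm_num at h9 h3
    exact apply_one_ne_zero ha h9 (h3.resolve_left h2)
  refine (card_le_natDegree hP fun x hx => ?_).trans ?_
  · simpa using hL x hx
  · compute_degree

/-- With `m = 2h + 5`, Frobenius twists bring every `y` to `y ^ 3 ^ (h + 4)`, and `x ^ 3 ^ m = x`
lowers the degree in `x` to 27. The order is a power of 3, so excluding 27 leaves at most 9. -/
theorem card_ker_polarForm_two {m : ℕ} (hm : 5 ≤ m) (hodd : Odd m)
    (hF : Fintype.card F = 3 ^ m) {a : Fin 2 → F} (ha : a ≠ 0) :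
    Nat.card (polarForm ![(m - 3) / 2, (m - 1) / 2] a).ker ≤ 9 := by
  obtain ⟨h, hh⟩ : ∃ h, m = 2 * h + 5 := by
    obtain ⟨r, rfl⟩ := hodd
    exact ⟨r - 2, by omega⟩
  have e1 : (m - 3) / 2 = h + 1 := by omega
  have e2 : (m - 1) / 2 = h + 2 := by omega
  rw [e1, e2]
  have hfrob : ∀ x : F, x ^ 3 ^ (2 * h + 5) = x := by
    intro x
    have := FiniteField.pow_card x
    rwa [hF, hh] at this
  have hL : ∀ x ∈ (polarForm ![h + 1, h + 2] a).ker,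
      a 0 ^ 27 * x ^ 27 + a 1 ^ 9 * x ^ 9 + a 1 ^ 3 ^ (h + 4) * x ^ 3 +
        a 0 ^ 3 ^ (h + 4) * x = 0 := by
    intro x hx
    refine eq_zero_of_trace_pow_mul_eq_zero (h + 4) fun y => ?_
    have hxy : polarForm ![h + 1, h + 2] a x y = 0 := by
      rw [AddMonoidHom.mem_ker.1 hx]
      rfl
    rw [polarForm_two] at hxy
    simp only [Matrix.cons_val_zero, Matrix.cons_val_one] at hxy
    rw [← trace_pow_three_pow (a 0 * x ^ 3 ^ (h + 1) * y) (h + 4),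
      ← trace_pow_three_pow (a 0 * x * y ^ 3 ^ (h + 1)) 3,
      ← trace_pow_three_pow (a 1 * x ^ 3 ^ (h + 2) * y) (h + 4),
      ← trace_pow_three_pow (a 1 * x * y ^ 3 ^ (h + 2)) 2, ← map_add, ← map_add, ← map_add] at hxy
    rw [← hxy]
    congr 1
    have f1 : (x ^ 3 ^ (h + 1)) ^ 3 ^ (h + 4) = x := by
      rw [← pow_mul, ← pow_add, show h + 1 + (h + 4) = 2 * h + 5 by ring, hfrob]
    have f2 : (x ^ 3 ^ (h + 2)) ^ 3 ^ (h + 4) = x ^ 3 := by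
      rw [← pow_mul, ← pow_add, show h + 2 + (h + 4) = 2 * h + 5 + 1 by ring, pow_succ, pow_mul,
        hfrob]
    have f3 : (y ^ 3 ^ (h + 1)) ^ 3 ^ 3 = y ^ 3 ^ (h + 4) := by
      rw [← pow_mul, ← pow_add]
    have f4 : (y ^ 3 ^ (h + 2)) ^ 3 ^ 2 = y ^ 3 ^ (h + 4) := by
      rw [← pow_mul, ← pow_add]
    rw [mul_pow, mul_pow, mul_pow _ (y ^ 3 ^ (h + 1)), mul_pow (a 0) x, f1, f3,
      mul_pow _ y, mul_pow _ (x ^ 3 ^ (h + 2)), f2, mul_pow _ (y ^ 3 ^ (h + 2)), mul_pow (a 1) x, f4]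
    norm_num
    ring
  have hdvd : Nat.card (polarForm ![h + 1, h + 2] a).ker ∣ 3 ^ m := by
    rw [← hF, ← Nat.card_eq_fintype_card]
    exact AddSubgroup.card_addSubgroup_dvd_card _
  by_cases h0 : a 0 = 0
  · have h1 := apply_one_ne_zero ha h0
    have hP : (Polynomial.C (a 1 ^ 9) * X ^ 9 + Polynomial.C (a 1 ^ 3 ^ (h + 4)) * X ^ 3 : F[X])
        ≠ 0 := by
      intro hP0
      have h9 := congrArg (fun P => coeff P 9) hP0
      simp only [coeff_add, coeff_C_mul, coeff_X_pow, coeff_zero] at h9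
      norm_num at h9
      exact h1 h9
    refine (card_le_natDegree hP fun x hx => ?_).trans ?_
    · simpa [h0] using hL x hx
    · compute_degree
  · have hP : (Polynomial.C (a 0 ^ 27) * X ^ 27 + Polynomial.C (a 1 ^ 9) * X ^ 9 +
        Polynomial.C (a 1 ^ 3 ^ (h + 4)) * X ^ 3 + Polynomial.C (a 0 ^ 3 ^ (h + 4)) * X : F[X])
        ≠ 0 := by
      intro hP0
      have h27 := congrArg (fun P => coeff P 27) hP0
      simp only [coeff_add, coeff_C_mul, coeff_X_pow, coeff_X, coeff_zero] at h27
      norm_num at h27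
      exact h0 h27
    have h27 : Nat.card (polarForm ![h + 1, h + 2] a).ker ≤ 27 := by
      refine (card_le_natDegree hP fun x hx => ?_).trans ?_
      · simpa using hL x hx
      · compute_degree
    have hne : Nat.card (polarForm ![h + 1, h + 2] a).ker ≠ 27 := by
      -- The extreme coefficients are both powers of `a 0`, with odd exponents, so their product is
      -- a square.
      refine card_ne_of_linearized (not_isSquare_neg_one hodd hF) (pow_ne_zero 27 h0) ?_ hL
      rw [← pow_add]
      have he : Even (27 + 3 ^ (h + 4)) := Odd.add_odd (by decide) (Odd.pow (by decide))
      exact he.isSquare_pow _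
    obtain ⟨d, -, hd⟩ := (Nat.dvd_prime_pow Nat.prime_three).1 hdvd
    rw [hd] at h27 hne ⊢
    have hd3 : d < 3 := by
      by_contra! hlt
      rcases hlt.eq_or_lt with rfl | hlt
      · exact hne rfl
      · have : 3 ^ 4 ≤ 3 ^ d := Nat.pow_le_pow_right (by norm_num) hlt
        omega
    calc 3 ^ d ≤ 3 ^ 2 := Nat.pow_le_pow_right (by norm_num) (by omega)
      _ = 9 := rfl

end Radicals

end TernaryDesigns

open TernaryDesigns

theorem mainTheorem3 (m : ℕ) (hm : 5 ≤ m) (hodd : Odd m)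
    {F : Type*} [Field F] [Fintype F] [Algebra (ZMod 3) F] (hF : Fintype.card F = 3 ^ m)
    (α : Fˣ) (hα : ∀ x : Fˣ, x ∈ Subgroup.zpowers α) :
    (∀ C : Submodule (ZMod 3) (Fin ((3 ^ m - 1) / 2) → ZMod 3),
      C ≤ TernaryDesigns.fullCode (α : F) m →
      TernaryDesigns.HasThreeWeightDistribution m C →
      TernaryDesigns.DualHoldsDesigns m C) ∧
    TernaryDesigns.DualHoldsDesigns m (TernaryDesigns.codeOne (α : F) m) ∧
    TernaryDesigns.DualHoldsDesigns m (TernaryDesigns.codeTwo (α : F) m) := by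
  have h1 : (codeOne (α : F) m) =
      traceCode (α : F) ((3 ^ m - 1) / 2) fun j => 3 ^ (![1, 0] : Fin 2 → ℕ) j + 1 := by
    rw [codeOne]
    congr 1
    ext j
    fin_cases j <;> rfl
  have h2 : (codeTwo (α : F) m) = traceCode (α : F) ((3 ^ m - 1) / 2)
      fun j => 3 ^ (![(m - 3) / 2, (m - 1) / 2] : Fin 2 → ℕ) j + 1 := by
    rw [codeTwo]
    congr 1
    ext j
    fin_cases j <;> rfl
  refine ⟨fun C hC hdist => ?_, ?_, ?_⟩
  · exact dualHoldsDesigns_of_distribution hm hodd (hdist.hasDistribution hm hodd)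
      fun T hT => two_le_card_wordsOn_four hm hF hα hC hT
  · refine dualHoldsDesigns_of_distribution hm hodd ?_
      fun T hT => two_le_card_wordsOn_four hm hF hα h1.le hT
    rw [h1]
    refine hasDistribution_of_card_ker_le hm hodd hF hα
      (fun a ha => card_ker_polarForm_one ha) (j := 1) fun z hz => ?_
    -- The index `j = 1` selects the exponent `3 ^ 0 + 1 = 2`.
    exact eq_or_eq_neg_of_sq_eq_sq _ _ (by simpa using hz)
  · refine dualHoldsDesigns_of_distribution hm hodd ?_
      fun T hT => two_le_card_wordsOn_four hm hF hα h2.le hT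
    rw [h2]
    exact hasDistribution_of_card_ker_le hm hodd hF hα
      (fun a ha => card_ker_polarForm_two hm hodd hF ha) (j := 1)
      fun z hz => eq_one_or_neg_one_of_pow hodd hF hz
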